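/- **Definitions.** Let $\mathbb N=\{1,2,\dots\}$. An infinite binary information system is a pair $U=(A,F)$ of an infinite set $A$ (objects) and an infinite set $F$ of functions $A\to\{0,1\}$ (attributes). A problem over $U$ is a tuple $z=(\nu,f_1,\dots,f_n)$ with $n\in\mathbb N$, $\nu:\{0,1\}^n\to\mathbb N$, $f_1,\dots,f_n\in F$; put $\dim z=n$ and $z(a)=\nu(f_1(a),\dots,f_n(a))$ for $a\in A$. A decision tree over $U$ is a finite rooted directed tree in which the root is not a terminal node, the root and the edges leaving it are unlabeled, each terminal node is labeled with a number from $\mathbb N$, each working node (neither the root nor terminal) is labeled with an attribute from $F$, and each edge leaving a working node is labeled with $0$ or $1$. It is deterministic if exactly one edge leaves the root and the edges leaving any working node have different labels. A complete path $\xi$ leads from the root to a terminal node; $A(\xi)$ is the set of $a\in A$ such that $f(a)=\delta$ for every working node of $\xi$, where $f$ is its attribute and $\delta$ is the label of the edge by which $\xi$ leaves it. The tree solves $z$ nondeterministically if every $a\in A$ lies in $A(\xi)$ for some complete path $\xi$, and whenever $a\in A(\xi)$ the terminal node of $\xi$ is labeled with $z(a)$; it solves $z$ deterministically if, moreover, it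 is deterministic. The depth $h(\Gamma)$ is the maximum number of working nodes in a complete path, and $L(\Gamma)$ is the number of all nodes of $\Gamma$. Let $h_U^d(z)$, $L_U^d(z)$ (respectively $h_U^a(z)$, $L_U^a(z)$) be the minimum depth and the minimum number of nodes of a decision tree over $U$ solving $z$ deterministically (respectively nondeterministically), and let $h_U^d(n),L_U^d(n),h_U^a(n),L_U^a(n)$ be the maxima of these numbers over all problems $z$ over $U$ with $\dim z\le n$. A finite set $S\subseteq F$ is independent if every assignment $S\to\{0,1\}$ equals $f\mapsto f(a)$ for some $a\in A$; $I(U)\in\mathbb N\cup\{0,\infty\}$ is the supremum of the cardinalities of independent finite subsets of $F$. $W_1$ is the class of infinite binary information systems $U$ of type (LOG, CON, POL, POL), that is: - for every $0<\varepsilon<1$ there is $c>0$ with $\log_2(n+1)\le h_U^d(n)\le c(\log_2 n)^{1+\varepsilon}+1$ for all $n\in\mathbb N$; - there is $c>0$ with $h_U^a(n)\le c$ for all $n\in\mathbb N$; - $I(U)<\infty$, and $2(n+1)\le L_U^d(n)\le 2(4n)^{I(U)}$ and $2(n+1)\le L_U^a(n)\le 2(4n)^{I(U)}$ for all $n\in\mathbb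 N$. A pair $(\varphi,\psi)$ of real-valued functions on $\mathbb N$ is a boundary $d$-pair (respectively boundary $a$-pair) of $U$ if for every problem $z$ over $U$ there is a decision tree $\Gamma$ over $U$ that solves $z$ deterministically (respectively nondeterministically) with $h(\Gamma)\le\varphi(\dim z)$ and $L(\Gamma)\le\psi(\dim z)$. $U$ is $d$-reachable if $(h_U^d,L_U^d)$ is a boundary $d$-pair of $U$, and $a$-reachable if $(h_U^a,L_U^a)$ is a boundary $a$-pair of $U$. Let $U_1=(\mathbb N,\{l_i:i\in\mathbb N\})$, where $l_i(j)=1$ iff $j>i$. Let $U_6=(\mathbb R_{\ge0},\{p_i:i\in\mathbb N\}\cup\{q_i:i\in\mathbb N\})$, where $p_i(a)=1$ iff $a=i$, and $q_i(a)=1$ iff $a\ge i+\tfrac12$. **Theorem 2.** (a) The class $W_1$ contains both $d$-reachable systems and systems that are not $d$-reachable: $U_1\in W_1$ is $d$-reachable, and $U_6\in W_1$ is not $d$-reachable. If $U\in W_1$ is not $d$-reachable, then for each $\varepsilon$ with $0<\varepsilon<1$ there is a constant $c>0$ such that $$\bigl(c(\log_2 n)^{1+\varepsilon}+1,\ 2^{c(\log_2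 n)^{1+\varepsilon}+2}\bigr)$$ is a boundary $d$-pair of $U$. (b) If $U\in W_1$, then $U$ is not $a$-reachable, and for each $\varepsilon$ with $0<\varepsilon<1$ there are constants $c_1,c_2,c_3>0$ such that $$\bigl(c_1,\ 2^{c_2(\log_2 n)^{1+\varepsilon}+c_3}\bigr)$$ is a boundary $a$-pair of $U$. -/

import Mathlib

open scoped NNReal

universe u

noncomputable section

/-- An infinite binary information system `(A, F)`: an infinite set `A` of objects and an infinite
set `F` of attributes `A → {0, 1}` (with `{0, 1}` modelled by `Bool`). -/
structure InfoSystem where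
  A : Type u
  F : Set (A → Bool)
  infinite_objects : Infinite A
  infinite_attributes : F.Infinite

namespace InfoSystem

/-- A problem `(ν, f₁, …, fₙ)`, `n ≥ 1`, with `ν : {0,1}ⁿ → {1, 2, …}`. -/
structure Problem (U : InfoSystem) where
  dim : ℕ
  dim_pos : 0 < dim
  ν : (Fin dim → Bool) → ℕ+
  f : Fin dim → U.F

/-- The value `z(a) = ν(f₁(a), …, fₙ(a))`. -/
def Problem.value {U : InfoSystem} (z : U.Problem) (a : U.A) : ℕ+ :=
  z.ν fun i => (z.f i).1 a

/-- A node of a decision tree different from the root, together with everything below it.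
A terminal node carries a positive integer; a working node carries an attribute and has
`k + 1 ≥ 1` leaving edges, the `i`-th one labeled with `lab i` and entering `child i`. -/
inductive Node (U : InfoSystem)
  | terminal (label : ℕ+) : Node U
  | working (f : U.F) (k : ℕ) (lab : Fin (k + 1) → Bool) (child : Fin (k + 1) → Node U) : Node U

namespace Node

variable {U : InfoSystem}

/-- Number of nodes. -/
def size : Node U → ℕ
  | terminal _ => 1
  | working _ _ _ child => 1 + ∑ i, (child i).size

/-- Maximum number of working nodes on a path down to a terminal node. -/
def depth : Node U → ℕ
  | terminal _ => 0
  | working _ _ _ child => 1 + Finset.univ.sup fun i => (child i).depth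

/-- Edges leaving a working node are labeled with different numbers. -/
def Deterministic : Node U → Prop
  | terminal _ => True
  | working _ _ lab child => Function.Injective lab ∧ ∀ i, (child i).Deterministic

/-- `v.IsPath e s`: some directed path from `v` to a terminal node labeled with `s` passes
successively through working nodes and edges with the (attribute, number) pairs listed in `e`. -/
inductive IsPath : Node U → List (U.F × Bool) → ℕ+ → Prop
  | terminal (s : ℕ+) : IsPath (.terminal s) [] s
  | working (f : U.F) (k : ℕ) (lab : Fin (k + 1) → Bool) (child : Fin (k + 1) → Node U)
      (i : Fin (k + 1)) (e : List (U.F × Bool)) (s : ℕ+) (h : IsPath (child i) e s) :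
      IsPath (.working f k lab child) ((f, lab i) :: e) s

end Node

/-- A decision tree: an unlabeled root with `k + 1 ≥ 1` unlabeled leaving edges. -/
structure DTree (U : InfoSystem) where
  k : ℕ
  child : Fin (k + 1) → Node U

namespace DTree

variable {U : InfoSystem}

/-- `L(Γ)`: the number of nodes, the root included. -/
def size (Γ : DTree U) : ℕ := 1 + ∑ i, (Γ.child i).size

/-- `h(Γ)`: the maximum number of working nodes in a complete path. -/
def depth (Γ : DTree U) : ℕ := Finset.univ.sup fun i => (Γ.child i).depth

/-- Only one edge leaves the root, and edges leaving a working node have different labels. -/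
def Deterministic (Γ : DTree U) : Prop := Γ.k = 0 ∧ ∀ i, (Γ.child i).Deterministic

/-- Complete paths, given by their list of equations and the label of the terminal node. -/
def IsCompletePath (Γ : DTree U) (e : List (U.F × Bool)) (s : ℕ+) : Prop :=
  ∃ i, (Γ.child i).IsPath e s

end DTree

/-- The set of solutions in `A` of a system of equations `f(x) = δ`. -/
def solutions (U : InfoSystem) (e : List (U.F × Bool)) : Set U.A :=
  {a | ∀ p ∈ e, p.1.1 a = p.2}

/-- `Γ` solves `z` nondeterministically. -/
def DTree.SolvesA {U : InfoSystem} (Γ : DTree U) (z : U.Problem) : Prop :=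
  (∀ a : U.A, ∃ e s, Γ.IsCompletePath e s ∧ a ∈ U.solutions e) ∧
  ∀ (a : U.A) (e : List (U.F × Bool)) (s : ℕ+),
    Γ.IsCompletePath e s → a ∈ U.solutions e → s = z.value a

/-- `Γ` solves `z` deterministically. -/
def DTree.SolvesD {U : InfoSystem} (Γ : DTree U) (z : U.Problem) : Prop :=
  Γ.Deterministic ∧ Γ.SolvesA z

variable (U : InfoSystem)

/-- `h_U^d(z)`, a minimum over a nonempty set of natural numbers. -/
def hdProblem (z : U.Problem) : ℕ := sInf {m | ∃ Γ : DTree U, Γ.SolvesD z ∧ Γ.depth = m}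

/-- `h_U^a(z)` -/
def haProblem (z : U.Problem) : ℕ := sInf {m | ∃ Γ : DTree U, Γ.SolvesA z ∧ Γ.depth = m}

/-- `L_U^d(z)` -/
def LdProblem (z : U.Problem) : ℕ := sInf {m | ∃ Γ : DTree U, Γ.SolvesD z ∧ Γ.size = m}

/-- `L_U^a(z)` -/
def LaProblem (z : U.Problem) : ℕ := sInf {m | ∃ Γ : DTree U, Γ.SolvesA z ∧ Γ.size = m}

/-- `h_U^d(n)`, the maximum over the problems of dimension at most `n` (the set is bounded by `n`,
because one can query all attributes of a problem one after another). -/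
def hd (n : ℕ) : ℕ := sSup {m | ∃ z : U.Problem, z.dim ≤ n ∧ U.hdProblem z = m}

/-- `h_U^a(n)` (bounded by `n`) -/
def ha (n : ℕ) : ℕ := sSup {m | ∃ z : U.Problem, z.dim ≤ n ∧ U.haProblem z = m}

/-- `L_U^d(n)` (bounded by `2 ^ (n + 1)`) -/
def Ld (n : ℕ) : ℕ := sSup {m | ∃ z : U.Problem, z.dim ≤ n ∧ U.LdProblem z = m}

/-- `L_U^a(n)` (bounded by `2 ^ (n + 1)`) -/
def La (n : ℕ) : ℕ := sSup {m | ∃ z : U.Problem, z.dim ≤ n ∧ U.LaProblem z = m}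

/-- A finite set of functions is independent if every assignment of values to its members is
attained at some object. -/
def Independent (S : Finset (U.A → Bool)) : Prop :=
  ∀ δ : (U.A → Bool) → Bool, ∃ a : U.A, ∀ f ∈ S, f a = δ f

/-- The independence dimension `I(U)`, the supremum of the cardinalities of independent finite
subsets of `F`. -/
def iDim : ℕ∞ :=
  ⨆ (S : Finset (U.A → Bool)) (_ : (S : Set (U.A → Bool)) ⊆ U.F ∧ U.Independent S), (S.card : ℕ∞)

/-- The type of behavior LOG of a function on `{1, 2, …}`. -/
def IsLOG (h : ℕ → ℕ) : Prop :=
  ∀ ε : ℝ, 0 < ε → ε < 1 → ∃ c : ℝ, 0 < c ∧ ∀ n : ℕ, 1 ≤ n →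
    Real.logb 2 ((n : ℝ) + 1) ≤ h n ∧ (h n : ℝ) ≤ c * (Real.logb 2 n) ^ (1 + ε) + 1

/-- The type of behavior CON of a function on `{1, 2, …}`. -/
def IsCON (h : ℕ → ℕ) : Prop :=
  ∃ c : ℝ, 0 < c ∧ ∀ n : ℕ, 1 ≤ n → (h n : ℝ) ≤ c

/-- The type of behavior POL of a function on `{1, 2, …}` attached to `U`: the dimension `I(U)` is
finite and `2 (n + 1) ≤ L(n) ≤ 2 (4 n) ^ I(U)`. -/
def IsPOL (L : ℕ → ℕ) : Prop :=
  ∃ d : ℕ, U.iDim = d ∧ ∀ n : ℕ, 1 ≤ n → 2 * (n + 1) ≤ L n ∧ L n ≤ 2 * (4 * n) ^ d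

/-- The class `W₁`: systems of type (LOG, CON, POL, POL). -/
def InW1 : Prop := IsLOG U.hd ∧ IsCON U.ha ∧ U.IsPOL U.Ld ∧ U.IsPOL U.La

/-- Boundary `d`-pairs. The bounds may be real-valued; as depth and number of nodes are integers,
this is the same as taking the integer parts of the bounds. -/
def IsBoundaryDPair (φ ψ : ℕ → ℝ) : Prop :=
  ∀ z : U.Problem, ∃ Γ : DTree U, Γ.SolvesD z ∧ (Γ.depth : ℝ) ≤ φ z.dim ∧ (Γ.size : ℝ) ≤ ψ z.dim

/-- Boundary `a`-pairs. -/
def IsBoundaryAPair (φ ψ : ℕ → ℝ) : Prop :=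
  ∀ z : U.Problem, ∃ Γ : DTree U, Γ.SolvesA z ∧ (Γ.depth : ℝ) ≤ φ z.dim ∧ (Γ.size : ℝ) ≤ ψ z.dim

def DReachable : Prop := U.IsBoundaryDPair (fun n => U.hd n) (fun n => U.Ld n)

def AReachable : Prop := U.IsBoundaryAPair (fun n => U.ha n) (fun n => U.La n)

/-- `l_i(j) = 1` iff `j > i`, on positive integers. -/
def attrL (i j : ℕ+) : Bool := decide (i < j)

/-- `p_i(a) = 1` iff `a = i`, on nonnegative reals. -/
def attrP (i : ℕ+) (a : ℝ≥0) : Bool := decide (a = ((i : ℕ) : ℝ≥0))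

/-- `q_i(a) = 1` iff `a ≥ i + 1/2`, on nonnegative reals. -/
def attrQ (i : ℕ+) (a : ℝ≥0) : Bool := decide (((i : ℕ) : ℝ≥0) + 1 / 2 ≤ a)

theorem attrL_injective : Function.Injective attrL := by
  intro i j h
  have h1 := congrFun h i
  have h2 := congrFun h j
  simp only [attrL, decide_eq_decide, lt_irrefl] at h1 h2
  grind

theorem attrP_injective : Function.Injective attrP := by
  intro i j h
  have h1 := congrFun h ((i : ℕ) : ℝ≥0)
  simpa [attrP] using h1

/-- The system with objects `{1, 2, …}` and attributes `l_i`, `i ≥ 1`. -/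
def U₁ : InfoSystem.{0} where
  A := ℕ+
  F := Set.range attrL
  infinite_objects := inferInstance
  infinite_attributes := Set.infinite_range_of_injective attrL_injective

/-- The system with objects the nonnegative reals and attributes `p_i`, `q_i`, `i ≥ 1`. -/
def U₆ : InfoSystem.{0} where
  A := ℝ≥0
  F := Set.range attrP ∪ Set.range attrQ
  infinite_objects := inferInstance
  infinite_attributes := (Set.infinite_range_of_injective attrP_injective).mono
    Set.subset_union_left

end InfoSystem

end

/-
A depth-`d` deterministic tree has at most `2 ^ (d + 1)` nodes, which gives the boundary `d`-pairs.
For nondeterministic trees, the solution set of `m` equations `f(a) = δ` is a level set of a problem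
of dimension `m`; if `h^d(m) ≤ m / 2`, it is covered by the solution sets of at most
`2 ^ h^d(m)` systems of half the length. Repeated halving stops at a bounded length, so that the
depth becomes bounded while the number of nodes stays `2 ^ O(h^d)`.

Against `a`-reachability: take a problem of dimension at most `n` whose attributes take the largest
number `N` of value tuples, and let its values identify the tuples. It is solved with `2 N` nodes,
and no problem of dimension at most `n` needs more. Nondeterministic branching only costs nodes, so
that even a nondeterministic tree with so few nodes has depth at least `log₂ N`, which is unbounded.

For `U₁`, binary search is optimal for both measures. For `U₆`, consider the problem of identifying
the tuple `(p₁(a), …, pₙ(a))`. A deterministic tree with the least number of nodes can only query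
`p₁, …, pₙ`, so that the path of `0` meets all of them, whereas `h^d(n)` is logarithmic.
-/

namespace InfoSystem

namespace Node

variable {U : InfoSystem.{u}} {v : Node U} {a : U.A} {e : List (U.F × Bool)} {s t : ℕ+} {f : U.F}
  {k : ℕ} {lab : Fin (k + 1) → Bool} {child : Fin (k + 1) → Node U}

theorem isPath_terminal : (terminal t : Node U).IsPath e s ↔ e = [] ∧ s = t := by
  constructor
  · rintro ⟨⟩
    exact ⟨rfl, rfl⟩
  · rintro ⟨rfl, rfl⟩
    exact .terminal _

theorem isPath_working :
    (working f k lab child).IsPath e s ↔ ∃ i e', (child i).IsPath e' s ∧ e = (f, lab i) :: e' := by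
  constructor
  · rintro ⟨⟩
    rename_i e i h
    exact ⟨i, e, h, rfl⟩
  · rintro ⟨i, e, h, rfl⟩
    exact .working _ _ _ _ _ _ _ h

/-- The multiset of attributes at the working nodes; its cardinality is the number of working
nodes. -/
noncomputable def attrs : Node U → Multiset U.F
  | terminal _ => 0
  | working f _ _ child => f ::ₘ ∑ i, (child i).attrs

/-- The multiset of paths down to a terminal node, each given as in `IsPath`; its cardinality is the
number of terminal nodes. -/
noncomputable def paths : Node U → Multiset (List (U.F × Bool) × ℕ+)
  | terminal s => {([], s)}
  | working f _ lab child => ∑ i, (child i).paths.map fun p => ((f, lab i) :: p.1, p.2)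

theorem mem_paths : (e, s) ∈ v.paths ↔ v.IsPath e s := by
  induction v generalizing e s with
  | terminal t => simp [paths, isPath_terminal]
  | working f k lab child ih =>
    simp only [paths, isPath_working, Multiset.mem_sum, Finset.mem_univ, true_and,
      Multiset.mem_map, Prod.exists, Prod.mk.injEq, ih]
    grind

theorem size_eq_card_attrs_add_card_paths (v : Node U) :
    v.size = v.attrs.card + v.paths.card := by
  induction v with
  | terminal t => simp [size, attrs, paths]
  | working f k lab child ih =>
    simp only [size, attrs, paths, ih, Multiset.card_cons, Multiset.card_sum, Multiset.card_map,
      Finset.sum_add_distrib]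
    ring

theorem depth_child_lt (f : U.F) (lab : Fin (k + 1) → Bool) (child : Fin (k + 1) → Node U)
    (i : Fin (k + 1)) : (child i).depth < (working f k lab child).depth := by
  rw [depth, add_comm, Nat.lt_succ_iff]
  exact Finset.le_sup (f := fun i => (child i).depth) (Finset.mem_univ i)

theorem IsPath.length_le_depth (h : v.IsPath e s) : e.length ≤ v.depth := by
  induction h with
  | terminal s => simp
  | working f k lab child i e _ _ ih => exact ih.trans_lt (depth_child_lt f lab child i)

theorem IsPath.mem_attrs (h : v.IsPath e s) {p : U.F × Bool} (hp : p ∈ e) : p.1 ∈ v.attrs := by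
  induction h with
  | terminal s => simp at hp
  | working f k lab child i e _ _ ih =>
    simp only [attrs, Multiset.mem_cons, Multiset.mem_sum]
    rcases List.mem_cons.1 hp with rfl | hp
    · exact .inl rfl
    · exact .inr ⟨i, Finset.mem_univ i, ih hp⟩

theorem sum_le_two_mul_of_injective_label (h : Function.Injective lab) {g : Fin (k + 1) → ℕ}
    {B : ℕ} (hg : ∀ i, g i ≤ B) : ∑ i, g i ≤ 2 * B := by
  have arity_le_two : k + 1 ≤ 2 := by simpa using Fintype.card_le_of_injective lab h
  calc ∑ i, g i
      ≤ (k + 1) * B := by simpa using Finset.sum_le_card_nsmul Finset.univ g B fun i _ => hg i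
    _ ≤ 2 * B := Nat.mul_le_mul_right B arity_le_two

theorem Deterministic.card_paths_le (h : v.Deterministic) : v.paths.card ≤ 2 ^ v.depth := by
  induction v with
  | terminal t => simp [paths, depth]
  | working f k lab child ih =>
    simp only [paths, depth, Multiset.card_sum, Multiset.card_map, pow_add, pow_one]
    exact sum_le_two_mul_of_injective_label h.1 fun i => (ih i (h.2 i)).trans <|
      Nat.pow_le_pow_right two_pos <|
        Finset.le_sup (f := fun i => (child i).depth) (Finset.mem_univ i)

theorem Deterministic.size_lt (h : v.Deterministic) : v.size < 2 ^ (v.depth + 1) := by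
  induction v with
  | terminal t => simp [size, depth]
  | working f k lab child ih =>
    set d := (working f k lab child).depth
    have size_child (i) : (child i).size ≤ 2 ^ d - 1 := Nat.le_sub_one_of_lt <|
      (ih i (h.2 i)).trans_le (Nat.pow_le_pow_right two_pos (depth_child_lt f lab child i))
    have size_children := sum_le_two_mul_of_injective_label h.1 size_child
    have := Nat.one_le_two_pow (n := d)
    rw [size, pow_succ]
    omega

/-- Some path of `v` followed by the object `a` ends in a terminal node labeled with `s`. -/
def Yields (v : Node U) (a : U.A) (s : ℕ+) : Prop :=
  ∃ e, v.IsPath e s ∧ a ∈ U.solutions e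

theorem yields_terminal : (terminal t : Node U).Yields a s ↔ s = t := by
  simp [Yields, isPath_terminal, solutions]

theorem yields_working :
    (working f k lab child).Yields a s ↔ ∃ i, f.1 a = lab i ∧ (child i).Yields a s := by
  simp only [Yields, isPath_working, solutions, Set.mem_ofPred_eq]
  constructor
  · rintro ⟨_, ⟨i, e, he, rfl⟩, ha⟩
    rw [List.forall_mem_cons] at ha
    exact ⟨i, ha.1, e, he, ha.2⟩
  · rintro ⟨i, hi, e, he, ha⟩
    exact ⟨_, ⟨i, e, he, rfl⟩, List.forall_mem_cons.2 ⟨hi, ha⟩⟩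

/-- A working node with one leaving edge for each of the two answers. -/
def query (f : U.F) (v : Bool → Node U) : Node U :=
  working f 1 (fun i => decide (i = 1)) fun i => v (decide (i = 1))

variable {w : Bool → Node U}

theorem depth_query : (query f w).depth = 1 + max (w false).depth (w true).depth := by
  simp [query, depth, Fin.univ_succ]

theorem size_query : (query f w).size = 1 + ((w false).size + (w true).size) := by
  simp [query, size, Fin.sum_univ_two]

theorem deterministic_query (h : ∀ b, (w b).Deterministic) : (query f w).Deterministic := by
  refine ⟨fun i j hij => ?_, fun i => h _⟩
  fin_cases i <;> fin_cases j <;> simp_all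

theorem yields_query : (query f w).Yields a s ↔ (w (f.1 a)).Yields a s := by
  rw [query, yields_working]
  cases f.1 a <;> simp

end Node

/-- How few working nodes can handle objects with the value set `T`, if `R` is the set of values
they lead to: `w` working nodes either lead to at most `w` values, or leave no more values to tell
apart than a deterministic tree with `w` working nodes and depth `d` could. -/
def WorkAlternative (R T : Set ℕ+) (w d : ℕ) : Prop :=
  R.ncard ≤ w ∨ T.ncard ≤ w + 1 ∧ T.ncard ≤ 2 ^ d

theorem workAlternative_biUnion {ι : Type*} {I : Finset ι} {R : ι → Set ℕ+} {T : Set ℕ+}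
    {w d : ι → ℕ} {D : ℕ} (hd : ∀ i ∈ I, d i ≤ D)
    (h : ∀ i ∈ I, WorkAlternative (R i) T (w i) (d i)) :
    WorkAlternative (⋃ i ∈ I, R i) T (∑ i ∈ I, w i) D := by
  by_cases hR : ∀ i ∈ I, (R i).ncard ≤ w i
  · exact .inl ((I.set_ncard_biUnion_le R).trans (Finset.sum_le_sum hR))
  · push Not at hR
    obtain ⟨i, hi, hiR⟩ := hR
    obtain ⟨hw, h2⟩ := (h i hi).resolve_left hiR.not_ge
    refine .inr ⟨hw.trans ?_, h2.trans (Nat.pow_le_pow_right two_pos (hd i hi))⟩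
    have := Finset.single_le_sum (f := w) (fun _ _ => Nat.zero_le _) hi
    omega

theorem workAlternative_union {R₀ R₁ T₀ T₁ : Set ℕ+} {w₀ w₁ d : ℕ}
    (hT₀ : T₀.Finite) (hT₁ : T₁.Finite) (hR₀ : R₀ ⊆ T₀) (hR₁ : R₁ ⊆ T₁)
    (h₀ : WorkAlternative R₀ T₀ w₀ d) (h₁ : WorkAlternative R₁ T₁ w₁ d) :
    WorkAlternative (R₀ ∪ R₁) (T₀ ∪ T₁) (w₀ + w₁ + 1) (1 + d) := by
  have := Set.ncard_union_le R₀ R₁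
  have := Set.ncard_union_le T₀ T₁
  have := Set.ncard_le_ncard hR₀ hT₀
  have := Set.ncard_le_ncard hR₁ hT₁
  simp only [WorkAlternative, pow_add, pow_one] at *
  omega

theorem sep_eq_false_union_sep_eq_true {α : Type*} (f : α → Bool) (X : Set α) :
    {a ∈ X | f a = false} ∪ {a ∈ X | f a = true} = X := by
  ext a
  cases h : f a <;> simp [h]

namespace Node

variable {U : InfoSystem.{u}} {X : Set U.A} {val : U.A → ℕ+}

theorem setOf_yields_working {f : U.F} {k : ℕ} {lab : Fin (k + 1) → Bool}
    {child : Fin (k + 1) → Node U} :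
    {s | ∃ a ∈ X, (working f k lab child).Yields a s} =
      (⋃ i ∈ Finset.univ.filter (lab · = false),
        {s | ∃ a ∈ {a ∈ X | f.1 a = false}, (child i).Yields a s}) ∪
      ⋃ i ∈ Finset.univ.filter (lab · = true),
        {s | ∃ a ∈ {a ∈ X | f.1 a = true}, (child i).Yields a s} := by
  ext s
  simp only [yields_working, Set.mem_ofPred_eq, Finset.mem_filter, Finset.mem_univ, true_and,
    Set.mem_union, Set.mem_iUnion, exists_prop]
  grind

theorem card_attrs_working (f : U.F) {k : ℕ} (lab : Fin (k + 1) → Bool)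
    (child : Fin (k + 1) → Node U) : (working f k lab child).attrs.card =
      ∑ i with lab i = false, (child i).attrs.card + ∑ i with lab i = true, (child i).attrs.card +
        1 := by
  have := Finset.sum_filter_add_sum_filter_not Finset.univ (lab · = false)
    fun i => (child i).attrs.card
  simp only [Bool.not_eq_false] at this
  simp [attrs, this]

theorem workAlternative {v : Node U} (hT : (val '' X).Finite)
    (h : ∀ a ∈ X, ∀ s, v.Yields a s → s = val a) :
    WorkAlternative {s | ∃ a ∈ X, v.Yields a s} (val '' X) v.attrs.card v.depth := by
  induction v generalizing X with
  | terminal s =>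
    have : val '' X ⊆ {s} := by
      rintro _ ⟨a, ha, rfl⟩
      exact (h a ha s (yields_terminal.2 rfl)).symm
    have := Set.ncard_le_ncard this
    rw [Set.ncard_singleton] at this
    exact .inr ⟨by omega, this⟩
  | working f k lab child ih =>
    let answer (b : Bool) : Set U.A := {a ∈ X | f.1 a = b}
    let R (b : Bool) : Set ℕ+ := ⋃ i ∈ Finset.univ.filter (lab · = b),
      {s | ∃ a ∈ answer b, (child i).Yields a s}
    let w (b : Bool) : ℕ := ∑ i with lab i = b, (child i).attrs.card
    have finite (b) : (val '' answer b).Finite := hT.subset (Set.image_mono (Set.sep_subset _ _))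
    have sound (i) : ∀ a ∈ answer (lab i), ∀ s, (child i).Yields a s → s = val a :=
      fun a ha s hs => h a ha.1 s (yields_working.2 ⟨i, ha.2, hs⟩)
    have R_subset (b) : R b ⊆ val '' answer b := by
      refine Set.iUnion₂_subset fun i hi => ?_
      obtain rfl := (Finset.mem_filter.1 hi).2
      rintro s ⟨a, ha, hs⟩
      exact ⟨a, ha, (sound i a ha s hs).symm⟩
    have alternative (b) : WorkAlternative (R b) (val '' answer b) (w b)
        (Finset.univ.sup fun i => (child i).depth) := by
      refine workAlternative_biUnion
        (fun i _ => Finset.le_sup (f := fun i => (child i).depth) (Finset.mem_univ i))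
        fun i hi => ?_
      obtain rfl := (Finset.mem_filter.1 hi).2
      exact ih i (finite _) (sound i)
    have T_eq : val '' X = val '' answer false ∪ val '' answer true := by
      rw [← Set.image_union, sep_eq_false_union_sep_eq_true]
    rw [setOf_yields_working, T_eq, card_attrs_working]
    exact workAlternative_union (finite false) (finite true) (R_subset false) (R_subset true)
      (alternative false) (alternative true)

end Node

variable {U : InfoSystem.{u}} {X : Set U.A} {val : U.A → ℕ+} {z : U.Problem} {d s : ℕ}

/-- The function `val` can be computed on `X` by a deterministic tree with depth at most `d` and at
most `s` nodes (not counting an unlabeled root). -/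
def ComputableWithin (val : U.A → ℕ+) (X : Set U.A) (d s : ℕ) : Prop :=
  ∃ v : Node U, v.Deterministic ∧ (∀ a ∈ X, ∀ t, v.Yields a t ↔ t = val a) ∧
    v.depth ≤ d ∧ v.size ≤ s

namespace ComputableWithin

theorem mono {d' s' : ℕ} (h : ComputableWithin val X d s) (hd : d ≤ d') (hs : s ≤ s') :
    ComputableWithin val X d' s' := by
  obtain ⟨v, hv, hval, hvd, hvs⟩ := h
  exact ⟨v, hv, hval, hvd.trans hd, hvs.trans hs⟩

theorem of_constant (h : ∀ a ∈ X, ∀ b ∈ X, val a = val b) : ComputableWithin val X 0 1 := by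
  obtain rfl | ⟨a, ha⟩ := X.eq_empty_or_nonempty
  · exact ⟨.terminal 1, trivial, by simp, le_rfl, le_rfl⟩
  · refine ⟨.terminal (val a), trivial, fun b hb t => ?_, le_rfl, le_rfl⟩
    rw [Node.yields_terminal, h a ha b hb]

theorem query {f : U.F} {s : Bool → ℕ}
    (h : ∀ b, ComputableWithin val {a ∈ X | f.1 a = b} d (s b)) :
    ComputableWithin val X (d + 1) (s false + s true + 1) := by
  choose v hdet hval hdepth hsize using h
  refine ⟨.query f v, Node.deterministic_query hdet, fun a ha t => ?_, ?_, ?_⟩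
  · rw [Node.yields_query]
    exact hval _ a ⟨ha, rfl⟩ t
  · rw [Node.depth_query, add_comm]
    exact Nat.succ_le_succ (max_le (hdepth _) (hdepth _))
  · rw [Node.size_query, add_comm]
    exact Nat.succ_le_succ (add_le_add (hsize _) (hsize _))

end ComputableWithin

namespace DTree

variable {Γ : DTree U}

theorem solvesA_iff_yields :
    Γ.SolvesA z ↔ ∀ a t, (∃ i, (Γ.child i).Yields a t) ↔ t = z.value a := by
  constructor
  · rintro ⟨hex, hval⟩ a t
    constructor
    · rintro ⟨i, e, he, ha⟩
      exact hval a e t ⟨i, he⟩ ha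
    · rintro rfl
      obtain ⟨e, s, ⟨i, he⟩, ha⟩ := hex a
      obtain rfl := hval a e s ⟨i, he⟩ ha
      exact ⟨i, e, he, ha⟩
  · intro h
    refine ⟨fun a => ?_, fun a e t ⟨i, he⟩ ha => (h a t).1 ⟨i, e, he, ha⟩⟩
    obtain ⟨i, e, he, ha⟩ := (h a _).2 rfl
    exact ⟨e, _, ⟨i, he⟩, ha⟩

theorem depth_child_le (Γ : DTree U) (i : Fin (Γ.k + 1)) : (Γ.child i).depth ≤ Γ.depth :=
  Finset.le_sup (f := fun i => (Γ.child i).depth) (Finset.mem_univ i)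

theorem depth_mk_zero (child : Fin (0 + 1) → Node U) :
    (⟨0, child⟩ : DTree U).depth = (child 0).depth := by
  simp [depth]

theorem size_mk_zero (child : Fin (0 + 1) → Node U) :
    (⟨0, child⟩ : DTree U).size = (child 0).size + 1 := by
  simp [size, add_comm]

theorem exists_solvesD_of_computableWithin (h : ComputableWithin z.value Set.univ d s) :
    ∃ Γ : DTree U, Γ.SolvesD z ∧ Γ.depth ≤ d ∧ Γ.size ≤ s + 1 := by
  obtain ⟨v, hdet, hval, hd, hs⟩ := h
  refine ⟨⟨0, fun _ => v⟩, ⟨⟨rfl, fun _ => hdet⟩, solvesA_iff_yields.2 fun a t => ?_⟩, ?_, ?_⟩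
  · simpa using hval a trivial t
  · rwa [depth_mk_zero]
  · rwa [size_mk_zero, add_le_add_iff_right]

theorem SolvesD.size_le (h : Γ.SolvesD z) : Γ.size ≤ 2 ^ (Γ.depth + 1) := by
  obtain ⟨k, child⟩ := Γ
  obtain ⟨⟨rfl : k = 0, hdet⟩, -⟩ := h
  rw [size_mk_zero, depth_mk_zero]
  exact (hdet 0).size_lt

theorem size_eq_sum_card_attrs_add_sum_card_paths (Γ : DTree U) :
    Γ.size = 1 + ∑ i, (Γ.child i).attrs.card + ∑ i, (Γ.child i).paths.card := by
  simp only [size, Node.size_eq_card_attrs_add_card_paths, Finset.sum_add_distrib, add_assoc]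

theorem SolvesA.finite_and_ncard_range_value_le (h : Γ.SolvesA z) :
    (Set.range z.value).Finite ∧
      (Set.range z.value).ncard ≤ ∑ i, (Γ.child i).paths.card := by
  classical
  let labels := ((∑ i, (Γ.child i).paths).map Prod.snd).toFinset
  have range_subset : Set.range z.value ⊆ labels := by
    rintro _ ⟨a, rfl⟩
    obtain ⟨i, e, he, -⟩ := (solvesA_iff_yields.1 h a _).2 rfl
    simp only [labels, Finset.mem_coe, Multiset.mem_toFinset, Multiset.mem_map, Multiset.mem_sum]
    exact ⟨_, ⟨i, Finset.mem_univ i, Node.mem_paths.2 he⟩, rfl⟩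
  refine ⟨labels.finite_toSet.subset range_subset, ?_⟩
  calc (Set.range z.value).ncard
      ≤ labels.card := by simpa using Set.ncard_le_ncard range_subset labels.finite_toSet
    _ ≤ ∑ i, (Γ.child i).paths.card := (Multiset.toFinset_card_le _).trans_eq <| by
        rw [Multiset.card_map, Multiset.card_sum]

theorem SolvesA.workAlternative (h : Γ.SolvesA z) :
    WorkAlternative (Set.range z.value) (Set.range z.value) (∑ i, (Γ.child i).attrs.card)
      Γ.depth := by
  rw [solvesA_iff_yields] at h
  have children : WorkAlternative _ (Set.range z.value) (∑ i, (Γ.child i).attrs.card) Γ.depth :=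
    workAlternative_biUnion (R := fun i => {s | ∃ a ∈ Set.univ, (Γ.child i).Yields a s})
      (fun i _ => Γ.depth_child_le i) fun i _ => by
        rw [← Set.image_univ]
        refine Node.workAlternative ?_ fun a _ s hs => (h a s).1 ⟨i, hs⟩
        rw [Set.image_univ]
        exact (solvesA_iff_yields.2 h).finite_and_ncard_range_value_le.1
  convert children using 1
  ext s
  simp only [Set.mem_range, Set.mem_iUnion, Set.mem_ofPred_eq, Set.mem_univ, true_and,
    Finset.mem_univ, exists_prop]
  rw [exists_comm]
  simp only [h, eq_comm]

theorem SolvesA.two_mul_ncard_range_value_le_size (h : Γ.SolvesA z) :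
    2 * (Set.range z.value).ncard ≤ Γ.size := by
  have := h.finite_and_ncard_range_value_le.2
  have := Γ.size_eq_sum_card_attrs_add_sum_card_paths
  rcases h.workAlternative with hw | ⟨hw, -⟩ <;> omega

theorem SolvesA.two_mul_ncard_range_value_lt_size (h : Γ.SolvesA z)
    (hd : 2 ^ Γ.depth < (Set.range z.value).ncard) : 2 * (Set.range z.value).ncard < Γ.size := by
  have := h.finite_and_ncard_range_value_le.2
  have := Γ.size_eq_sum_card_attrs_add_sum_card_paths
  rcases h.workAlternative with hw | ⟨-, hw⟩ <;> omega

theorem SolvesD.ncard_range_value_le (h : Γ.SolvesD z) :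
    (Set.range z.value).ncard ≤ 2 ^ Γ.depth := by
  by_contra! hlt
  have := h.2.two_mul_ncard_range_value_lt_size hlt
  have := h.size_le
  omega

end DTree

/-- The answers that the objects of `X` give to the successive attributes of the list `fs`. -/
def answers (fs : List U.F) (X : Set U.A) : Set (List Bool) :=
  (fun a => fs.map fun f => f.1 a) '' X

theorem finite_answers (fs : List U.F) (X : Set U.A) : (answers fs X).Finite := by
  refine (List.finite_length_eq Bool fs.length).subset ?_
  rintro _ ⟨a, -, rfl⟩
  simp

theorem ncard_answers_cons (f : U.F) (fs : List U.F) (X : Set U.A) :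
    (answers (f :: fs) X).ncard =
      (answers fs {a ∈ X | f.1 a = false}).ncard + (answers fs {a ∈ X | f.1 a = true}).ncard := by
  have split : answers (f :: fs) X = List.cons false '' answers fs {a ∈ X | f.1 a = false} ∪
      List.cons true '' answers fs {a ∈ X | f.1 a = true} := by
    conv_lhs => rw [answers, ← sep_eq_false_union_sep_eq_true f.1 X, Set.image_union]
    simp only [answers, Set.image_image]
    congr 1 <;> exact Set.image_congr fun a ha => by rw [List.map_cons, ha.2]
  rw [split, Set.ncard_union_eq ?_ ((finite_answers _ _).image _) ((finite_answers _ _).image _),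
    Set.ncard_image_of_injective _ List.cons_injective,
    Set.ncard_image_of_injective _ List.cons_injective]
  rw [Set.disjoint_left]
  rintro _ ⟨l, -, rfl⟩ ⟨l', -, h⟩
  simp at h

theorem computableWithin_answers {fs : List U.F} (hX : X.Nonempty)
    (hval : ∀ a ∈ X, ∀ b ∈ X, (∀ f ∈ fs, f.1 a = f.1 b) → val a = val b) :
    ComputableWithin val X fs.length (2 * (answers fs X).ncard - 1) := by
  have one_le_answers {fs : List U.F} {Y : Set U.A} (hY : Y.Nonempty) :
      1 ≤ (answers fs Y).ncard :=
    (Set.ncard_pos (finite_answers fs Y)).2 (hY.image _)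
  induction fs generalizing X with
  | nil =>
    have := one_le_answers (fs := []) hX
    exact (ComputableWithin.of_constant fun a ha b hb => hval a ha b hb (by simp)).mono le_rfl
      (by omega)
  | cons f fs ih =>
    let Y (b : Bool) : Set U.A := {a ∈ X | f.1 a = b}
    have card_eq := ncard_answers_cons f fs X
    by_cases hY : ∀ b, (Y b).Nonempty
    · have branch (b) : ComputableWithin val (Y b) fs.length (2 * (answers fs (Y b)).ncard - 1) :=
        ih (hY b) fun a ha a' ha' h => hval a ha.1 a' ha'.1 <|
          List.forall_mem_cons.2 ⟨ha.2.trans ha'.2.symm, h⟩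
      have := one_le_answers (fs := fs) (hY false)
      have := one_le_answers (fs := fs) (hY true)
      exact (ComputableWithin.query branch).mono le_rfl (by simp only [Y] at *; omega)
    · obtain ⟨b, hb⟩ : ∃ b, ∀ a ∈ X, f.1 a = b := by
        simp only [Y, not_forall, Set.not_nonempty_iff_eq_empty,
          Set.sep_eq_empty_iff_mem_false] at hY
        obtain ⟨b, hb⟩ := hY
        exact ⟨!b, fun a ha => Bool.eq_not_of_ne (hb a ha)⟩
      have constant : ComputableWithin val X fs.length (2 * (answers fs X).ncard - 1) :=
        ih hX fun a ha a' ha' h => hval a ha a' ha' <|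
          List.forall_mem_cons.2 ⟨(hb a ha).trans (hb a' ha').symm, h⟩
      have X_eq : {a ∈ X | f.1 a = b} = X := Set.sep_eq_self_iff_mem_true.2 hb
      refine constant.mono (Nat.le_succ _) ?_
      cases b <;> rw [X_eq] at card_eq <;> omega

/-- The tuples of values of the attributes `f` at the objects. -/
def patterns {n : ℕ} (f : Fin n → U.F) : Set (Fin n → Bool) := Set.range fun a i => (f i).1 a

theorem ncard_patterns_le {n : ℕ} (f : Fin n → U.F) : (patterns f).ncard ≤ 2 ^ n := by
  simpa using Set.ncard_le_card (patterns f)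

theorem ncard_answers_ofFn {n : ℕ} (f : Fin n → U.F) :
    (answers (List.ofFn f) Set.univ).ncard = (patterns f).ncard := by
  rw [← Set.ncard_image_of_injective (patterns f) List.ofFn_injective, answers, patterns,
    Set.image_univ, ← Set.range_comp]
  simp [List.map_ofFn, Function.comp_def]

theorem Problem.value_eq_of_forall_eq (z : U.Problem) {a b : U.A}
    (h : ∀ k, (z.f k).1 a = (z.f k).1 b) : z.value a = z.value b :=
  congrArg z.ν (funext h)

theorem Problem.exists_solvesD (z : U.Problem) :
    ∃ Γ : DTree U, Γ.SolvesD z ∧ Γ.depth ≤ z.dim ∧ Γ.size ≤ 2 * (patterns z.f).ncard := by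
  have := U.infinite_objects
  obtain ⟨Γ, hΓ, hd, hs⟩ := DTree.exists_solvesD_of_computableWithin
    (computableWithin_answers (fs := List.ofFn z.f) Set.univ_nonempty fun a _ b _ h =>
      z.value_eq_of_forall_eq fun i => h _ (List.mem_ofFn.2 ⟨i, rfl⟩))
  have one_le : 1 ≤ (patterns z.f).ncard :=
    (Set.ncard_pos (Set.toFinite _)).2 (Set.range_nonempty _)
  rw [List.length_ofFn] at hd
  rw [ncard_answers_ofFn] at hs
  exact ⟨Γ, hΓ, hd, by omega⟩

section WorstCost

variable {S : DTree U → U.Problem → Prop} {μ : DTree U → ℕ} {n : ℕ}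

/-- The minimum of the cost `μ` over the trees that solve `z` in the sense `S`. The four choices of
`S` and `μ` give `hdProblem`, `haProblem`, `LdProblem` and `LaProblem`. -/
noncomputable def problemCost (S : DTree U → U.Problem → Prop) (μ : DTree U → ℕ) (z : U.Problem) :
    ℕ :=
  sInf {m | ∃ Γ : DTree U, S Γ z ∧ μ Γ = m}

/-- The maximum of `problemCost` over the problems of dimension at most `n`. The four choices of `S`
and `μ` give `hd`, `ha`, `Ld` and `La`. -/
noncomputable def worstCost (S : DTree U → U.Problem → Prop) (μ : DTree U → ℕ) (n : ℕ) : ℕ :=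
  sSup {m | ∃ z : U.Problem, z.dim ≤ n ∧ problemCost S μ z = m}

theorem problemCost_le {Γ : DTree U} (hΓ : S Γ z) : problemCost S μ z ≤ μ Γ :=
  Nat.sInf_le ⟨Γ, hΓ, rfl⟩

theorem exists_le_worstCost {g : ℕ → ℕ} (hg : Monotone g)
    (h : ∀ z, ∃ Γ, S Γ z ∧ μ Γ ≤ g z.dim) (hz : z.dim ≤ n) :
    ∃ Γ, S Γ z ∧ μ Γ ≤ worstCost S μ n := by
  have bounded : BddAbove {m | ∃ z : U.Problem, z.dim ≤ n ∧ problemCost S μ z = m} := by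
    refine ⟨g n, ?_⟩
    rintro _ ⟨y, hy, rfl⟩
    obtain ⟨Γ, hΓ, hμ⟩ := h y
    exact (problemCost_le hΓ).trans (hμ.trans (hg hy))
  obtain ⟨Γ, hΓ, -⟩ := h z
  obtain ⟨Γ, hΓ, hμ⟩ := Nat.sInf_mem (s := {m | ∃ Γ : DTree U, S Γ z ∧ μ Γ = m}) ⟨_, Γ, hΓ, rfl⟩
  exact ⟨Γ, hΓ, hμ.trans_le (le_csSup bounded ⟨z, hz, rfl⟩)⟩

theorem exists_problem_dim_le (U : InfoSystem.{u}) (hn : 1 ≤ n) : ∃ z : U.Problem, z.dim ≤ n := by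
  obtain ⟨f, hf⟩ := U.infinite_attributes.nonempty
  exact ⟨⟨1, one_pos, fun _ => 1, fun _ => ⟨f, hf⟩⟩, hn⟩

theorem worstCost_le {B : ℕ} (hn : 1 ≤ n)
    (h : ∀ z : U.Problem, z.dim ≤ n → ∃ Γ, S Γ z ∧ μ Γ ≤ B) : worstCost S μ n ≤ B := by
  obtain ⟨z, hz⟩ := U.exists_problem_dim_le hn
  refine csSup_le ⟨_, z, hz, rfl⟩ ?_
  rintro _ ⟨z, hz, rfl⟩
  obtain ⟨Γ, hΓ, hμ⟩ := h z hz
  exact (problemCost_le hΓ).trans hμ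

theorem Problem.exists_solvesD_size_le_two_pow (z : U.Problem) :
    ∃ Γ : DTree U, Γ.SolvesD z ∧ Γ.size ≤ 2 * 2 ^ z.dim := by
  obtain ⟨Γ, hΓ, -, hs⟩ := z.exists_solvesD
  exact ⟨Γ, hΓ, hs.trans (Nat.mul_le_mul_left 2 (ncard_patterns_le z.f))⟩

theorem monotone_two_mul_two_pow : Monotone fun n : ℕ => 2 * 2 ^ n := fun _ _ h =>
  Nat.mul_le_mul_left 2 (Nat.pow_le_pow_right two_pos h)

theorem exists_solvesD_depth_le_hd (hz : z.dim ≤ n) :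
    ∃ Γ : DTree U, Γ.SolvesD z ∧ Γ.depth ≤ U.hd n :=
  exists_le_worstCost monotone_id
    (fun z => (z.exists_solvesD).imp fun _ h => ⟨h.1, h.2.1⟩) hz

theorem exists_solvesD_size_le_Ld (hz : z.dim ≤ n) :
    ∃ Γ : DTree U, Γ.SolvesD z ∧ Γ.size ≤ U.Ld n :=
  exists_le_worstCost monotone_two_mul_two_pow Problem.exists_solvesD_size_le_two_pow hz

theorem exists_solvesA_size_le_La (hz : z.dim ≤ n) :
    ∃ Γ : DTree U, Γ.SolvesA z ∧ Γ.size ≤ U.La n :=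
  exists_le_worstCost monotone_two_mul_two_pow
    (fun z => z.exists_solvesD_size_le_two_pow.imp fun _ h => ⟨h.1.2, h.2⟩) hz

theorem Ld_le_of_ncard_patterns_le {B : ℕ} (hn : 1 ≤ n)
    (h : ∀ z : U.Problem, z.dim ≤ n → (patterns z.f).ncard ≤ B) : U.Ld n ≤ 2 * B :=
  worstCost_le hn fun z hz => by
    obtain ⟨Γ, hΓ, -, hs⟩ := z.exists_solvesD
    exact ⟨Γ, hΓ, hs.trans (Nat.mul_le_mul_left 2 (h z hz))⟩

theorem La_le_Ld (U : InfoSystem.{u}) (hn : 1 ≤ n) : U.La n ≤ U.Ld n :=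
  worstCost_le hn fun _ hz => (exists_solvesD_size_le_Ld hz).imp fun _ h => ⟨h.1.2, h.2⟩

end WorstCost

/-- The problem of recognizing the values of all the attributes `f₁, …, fₙ`. -/
def identify {n : ℕ} (hn : 0 < n) (f : Fin n → U.F) : U.Problem where
  dim := n
  dim_pos := hn
  ν b := Nat.succPNat (Encodable.encode b)
  f := f

theorem ncard_range_value_identify {n : ℕ} (hn : 0 < n) (f : Fin n → U.F) :
    (Set.range (identify hn f).value).ncard = (patterns f).ncard := by
  rw [← Set.ncard_image_of_injective (patterns f)
    (Nat.succPNat_injective.comp Encodable.encode_injective), patterns, ← Set.range_comp]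
  rfl

section Growth

variable {n : ℕ}

theorem exists_attribute_separating (U : InfoSystem.{u}) (f : Fin n → U.F) :
    ∃ g ∈ U.F, ∃ a b, (∀ i, (f i).1 a = (f i).1 b) ∧ g a ≠ g b := by
  by_contra! h
  refine U.infinite_attributes ((Set.finite_range fun (φ : (Fin n → Bool) → Bool) a =>
    φ fun i => (f i).1 a).subset fun g hg => ?_)
  obtain ⟨φ, hφ⟩ := (Function.factorsThrough_iff g).1
    fun a b hab => h g hg a b (congrFun (f := fun i => (f i).1 a) hab)
  exact ⟨φ, hφ.symm⟩

theorem exists_lt_ncard_patterns (U : InfoSystem.{u}) (n : ℕ) :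
    ∃ f : Fin n → U.F, n < (patterns f).ncard := by
  induction n with
  | zero =>
    have := U.infinite_objects
    exact ⟨Fin.elim0, (Set.ncard_pos (Set.toFinite _)).2 (Set.range_nonempty _)⟩
  | succ n ih =>
    obtain ⟨f, hf⟩ := ih
    obtain ⟨g, hg, a, b, hab, hgab⟩ := U.exists_attribute_separating f
    let f' : Fin (n + 1) → U.F := Fin.cons ⟨g, hg⟩ f
    have tail_image : Fin.tail '' patterns f' = patterns f := (Set.range_comp _ _).symm
    have not_injOn : ¬ Set.InjOn Fin.tail (patterns f') := fun h =>
      hgab (congrFun (h (Set.mem_range_self a) (Set.mem_range_self b) (funext hab)) 0)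
    rw [← Set.ncard_image_iff, tail_image] at not_injOn
    have := Set.ncard_image_le (f := Fin.tail) (Set.toFinite (patterns f'))
    rw [tail_image] at this
    exact ⟨f', by omega⟩

theorem exists_problem_lt_ncard_range_value (U : InfoSystem.{u}) (hn : 1 ≤ n) :
    ∃ z : U.Problem, z.dim ≤ n ∧ n < (Set.range z.value).ncard := by
  obtain ⟨f, hf⟩ := U.exists_lt_ncard_patterns n
  exact ⟨identify hn f, le_rfl, by rwa [ncard_range_value_identify]⟩

theorem lt_two_pow_hd (U : InfoSystem.{u}) (hn : 1 ≤ n) : n < 2 ^ U.hd n := by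
  obtain ⟨z, hz, hzn⟩ := U.exists_problem_lt_ncard_range_value hn
  obtain ⟨Γ, hΓ, hd⟩ := exists_solvesD_depth_le_hd hz
  exact hzn.trans_le (hΓ.ncard_range_value_le.trans (Nat.pow_le_pow_right two_pos hd))

theorem two_mul_succ_le_La (U : InfoSystem.{u}) (hn : 1 ≤ n) : 2 * (n + 1) ≤ U.La n := by
  obtain ⟨z, hz, hzn⟩ := U.exists_problem_lt_ncard_range_value hn
  obtain ⟨Γ, hΓ, hs⟩ := exists_solvesA_size_le_La hz
  exact (Nat.mul_le_mul_left 2 hzn).trans (hΓ.two_mul_ncard_range_value_le_size.trans hs)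

theorem exists_problem_max_ncard_patterns (U : InfoSystem.{u}) (hn : 1 ≤ n) :
    ∃ z : U.Problem, z.dim ≤ n ∧
      ∀ y : U.Problem, y.dim ≤ n → (patterns y.f).ncard ≤ (patterns z.f).ncard := by
  let S := {m | ∃ z : U.Problem, z.dim ≤ n ∧ (patterns z.f).ncard = m}
  have bounded : BddAbove S := by
    refine ⟨2 ^ n, ?_⟩
    rintro _ ⟨z, hz, rfl⟩
    exact (ncard_patterns_le z.f).trans (Nat.pow_le_pow_right two_pos hz)
  obtain ⟨y, hy⟩ := U.exists_problem_dim_le hn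
  obtain ⟨z, hz, hmax⟩ := Nat.sSup_mem (s := S) ⟨_, y, hy, rfl⟩ bounded
  exact ⟨z, hz, fun y hy => hmax ▸ le_csSup bounded ⟨y, hy, rfl⟩⟩

theorem not_AReachable_of_isCON_ha (h : IsCON U.ha) : ¬ U.AReachable := by
  intro hreach
  obtain ⟨c, -, hc⟩ := h
  let m := 2 ^ ⌊c⌋₊
  obtain ⟨z, hzm, hmax⟩ := U.exists_problem_max_ncard_patterns (n := m) Nat.one_le_two_pow
  obtain ⟨f, hf⟩ := U.exists_lt_ncard_patterns m
  have many_patterns : m < (patterns z.f).ncard :=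
    hf.trans_le (hmax (identify (Nat.two_pow_pos _) f) le_rfl)
  obtain ⟨Γ, hΓ, hd, hs⟩ := hreach (identify z.dim_pos z.f)
  have shallow : Γ.depth ≤ ⌊c⌋₊ := Nat.le_floor (hd.trans (hc _ z.dim_pos))
  have small : Γ.size ≤ 2 * (patterns z.f).ncard := (Nat.cast_le.1 hs).trans <|
    (U.La_le_Ld z.dim_pos).trans <|
      Ld_le_of_ncard_patterns_le z.dim_pos fun y hy => hmax y (hy.trans hzm)
  refine small.not_gt ?_
  rw [← ncard_range_value_identify z.dim_pos]
  refine hΓ.two_mul_ncard_range_value_lt_size ?_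
  rw [ncard_range_value_identify]
  exact (Nat.pow_le_pow_right two_pos shallow).trans_lt many_patterns

end Growth

section SauerShelah

variable {n d : ℕ} {f : Fin n → U.F}

open Classical in
/-- The tuples of `patterns f`, regarded as a family of subsets of `Fin n`. -/
noncomputable def patternFamily (f : Fin n → U.F) : Finset (Finset (Fin n)) :=
  {s | ∃ a, ∀ i, i ∈ s ↔ (f i).1 a = true}

theorem ncard_patterns_le_card_patternFamily (f : Fin n → U.F) :
    (patterns f).ncard ≤ (patternFamily f).card := by
  classical
  let indicator (s : Finset (Fin n)) (i : Fin n) : Bool := decide (i ∈ s)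
  have patterns_subset : patterns f ⊆ (patternFamily f).image indicator := by
    rintro _ ⟨a, rfl⟩
    refine Finset.mem_coe.2 <| Finset.mem_image.2
      ⟨Finset.univ.filter fun i => (f i).1 a = true, ?_, ?_⟩
    · exact Finset.mem_filter.2 ⟨Finset.mem_univ _, a, by simp⟩
    · simp [indicator]
  calc (patterns f).ncard
      ≤ ((patternFamily f).image indicator).card := by
        simpa only [Set.ncard_coe_finset] using Set.ncard_le_ncard patterns_subset
    _ ≤ (patternFamily f).card := Finset.card_image_le

theorem card_le_iDim_of_shatters {s : Finset (Fin n)} (h : (patternFamily f).Shatters s) :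
    (s.card : ℕ∞) ≤ U.iDim := by
  classical
  have injOn : Set.InjOn (fun i => (f i).1) s := by
    intro i hi j hj hij
    obtain ⟨t, ht, hst⟩ := h.exists_inter_eq_singleton hi
    obtain ⟨a, ha⟩ := (Finset.mem_filter.1 ht).2
    have i_mem : i ∈ s ∩ t := hst ▸ Finset.mem_singleton_self i
    have j_mem : j ∈ s ∩ t := Finset.mem_inter.2
      ⟨hj, (ha j).2 <| (congrFun hij a).symm.trans <|
        (ha i).1 (Finset.mem_inter.1 i_mem).2⟩
    exact (Finset.mem_singleton.1 (hst ▸ j_mem)).symm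
  rw [← Finset.card_image_of_injOn injOn]
  refine le_iSup₂_of_le (s.image fun i => (f i).1) ⟨?_, fun δ => ?_⟩ le_rfl
  · simp [Set.subset_def]
  · obtain ⟨t, ht, hst⟩ := h (Finset.filter_subset (fun i => δ (f i).1 = true) s)
    obtain ⟨a, ha⟩ := (Finset.mem_filter.1 ht).2
    refine ⟨a, Finset.forall_mem_image.2 fun i hi => Bool.eq_iff_iff.2 ?_⟩
    simpa [hi, ha] using Finset.ext_iff.1 hst i

theorem ncard_patterns_le_of_iDim_le (h : U.iDim ≤ d) : (patterns f).ncard ≤ (n + 1) ^ d := by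
  have vcDim_le : (patternFamily f).vcDim ≤ d := Finset.sup_le fun s hs =>
    Nat.cast_le.1 ((card_le_iDim_of_shatters (Finset.mem_shatterer.1 hs)).trans h)
  calc (patterns f).ncard
      ≤ (patternFamily f).card := ncard_patterns_le_card_patternFamily f
    _ ≤ (patternFamily f).shatterer.card := (patternFamily f).card_le_card_shatterer
    _ ≤ ∑ k ∈ Finset.Iic (patternFamily f).vcDim, n.choose k := by
        simpa using Finset.card_shatterer_le_sum_vcDim (𝒜 := patternFamily f)
    _ ≤ ∑ k ∈ Finset.range (d + 1), n.choose k :=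
        Finset.sum_le_sum_of_subset fun k hk =>
          Finset.mem_range.2 (Nat.lt_succ_of_le ((Finset.mem_Iic.1 hk).trans vcDim_le))
    _ ≤ ∑ k ∈ Finset.range (d + 1), n ^ k * 1 ^ (d - k) * d.choose k :=
        Finset.sum_le_sum fun k hk => by
          rw [one_pow, mul_one]
          exact (Nat.choose_le_pow n k).trans (Nat.le_mul_of_pos_right _
            (Nat.choose_pos (Finset.mem_range_succ_iff.1 hk)))
    _ = (n + 1) ^ d := (add_pow n 1 d).symm

theorem Ld_le_of_iDim_le (h : U.iDim ≤ d) (hn : 1 ≤ n) : U.Ld n ≤ 2 * (n + 1) ^ d :=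
  Ld_le_of_ncard_patterns_le hn fun _ hz =>
    (ncard_patterns_le_of_iDim_le h).trans (Nat.pow_le_pow_left (Nat.succ_le_succ hz) d)

theorem isPOL_of_iDim_eq (h : U.iDim = d) : U.IsPOL U.Ld ∧ U.IsPOL U.La := by
  have upper {n : ℕ} (hn : 1 ≤ n) : U.Ld n ≤ 2 * (4 * n) ^ d :=
    (Ld_le_of_iDim_le h.le hn).trans
      (Nat.mul_le_mul_left 2 (Nat.pow_le_pow_left (by omega) d))
  exact ⟨⟨d, h, fun n hn => ⟨(U.two_mul_succ_le_La hn).trans (U.La_le_Ld hn), upper hn⟩⟩,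
    ⟨d, h, fun n hn => ⟨U.two_mul_succ_le_La hn, (U.La_le_Ld hn).trans (upper hn)⟩⟩⟩

/-- No two different attributes are independent. -/
def PairDependent (U : InfoSystem.{u}) : Prop :=
  ∀ f ∈ U.F, ∀ g ∈ U.F, f ≠ g → ∃ δ ε, ∀ a, ¬ (f a = δ ∧ g a = ε)

theorem one_le_iDim (U : InfoSystem.{u}) : 1 ≤ U.iDim := by
  obtain ⟨g, hg, a, b, -, hab⟩ := U.exists_attribute_separating Fin.elim0
  refine le_iSup₂_of_le {g} ⟨by simpa using hg, fun δ => ?_⟩ (by simp)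
  simp only [Finset.mem_singleton, forall_eq]
  by_cases ha : g a = δ g
  · exact ⟨a, ha⟩
  · exact ⟨b, by revert ha hab; cases g a <;> cases g b <;> cases δ g <;> simp⟩

theorem PairDependent.iDim_eq_one (h : U.PairDependent) : U.iDim = 1 := by
  classical
  refine le_antisymm (iSup₂_le fun S ⟨hSF, hS⟩ => ?_) U.one_le_iDim
  suffices S.card ≤ 1 by exact_mod_cast this
  refine Finset.card_le_one.2 fun f hf g hg => ?_
  by_contra hfg
  obtain ⟨δ, ε, hd⟩ := h f (hSF hf) g (hSF hg) hfg
  obtain ⟨a, ha⟩ := hS fun k => if k = f then δ else ε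
  exact hd a ⟨by simpa using ha f hf, by simpa [Ne.symm hfg] using ha g hg⟩

end SauerShelah

section PathCovers

variable {N l M : ℕ} {e : List (U.F × Bool)} {t : ℕ+}

/-- The set `X` is a union of at most `N` solution sets of systems of at most `l` equations. -/
def HasPathCover (X : Set U.A) (N l : ℕ) : Prop :=
  ∃ P : Finset (List (U.F × Bool)), P.card ≤ N ∧ (∀ e ∈ P, e.length ≤ l) ∧
    X = ⋃ e ∈ P, U.solutions e

namespace HasPathCover

theorem mono {N' l' : ℕ} (h : HasPathCover X N l) (hN : N ≤ N') (hl : l ≤ l') :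
    HasPathCover X N' l' := by
  obtain ⟨P, hPN, hPl, hP⟩ := h
  exact ⟨P, hPN.trans hN, fun e he => (hPl e he).trans hl, hP⟩

theorem of_solutions (e : List (U.F × Bool)) : HasPathCover (U.solutions e) 1 e.length :=
  ⟨{e}, by simp, by simp, by simp⟩

theorem trans {N' l' : ℕ} (h : HasPathCover X N l)
    (h' : ∀ e : List (U.F × Bool), e.length ≤ l → HasPathCover (U.solutions e) N' l') :
    HasPathCover X (N * N') l' := by
  classical
  obtain ⟨P, hPN, hPl, rfl⟩ := h
  choose! Q hQN hQl hQ using h'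
  refine ⟨P.biUnion Q, ?_, fun e he => ?_, ?_⟩
  · exact (Finset.card_biUnion_le_card_mul P Q N' fun e he => hQN e (hPl e he)).trans
      (Nat.mul_le_mul_right N' hPN)
  · obtain ⟨e', he', he⟩ := Finset.mem_biUnion.1 he
    exact hQl e' (hPl e' he') e he
  · rw [Finset.set_biUnion_biUnion]
    exact Set.iUnion₂_congr fun e he => hQ e (hPl e he)

end HasPathCover

theorem Problem.hasPathCover_value_eq (z : U.Problem) (t : ℕ+) :
    HasPathCover {a | z.value a = t} (2 ^ U.hd z.dim) (U.hd z.dim) := by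
  classical
  obtain ⟨⟨k, child⟩, ⟨⟨rfl : k = 0, hdet⟩, hsol⟩, hd⟩ :=
    exists_solvesD_depth_le_hd (le_refl z.dim)
  rw [DTree.depth_mk_zero] at hd
  have mem_iff {e} : e ∈ (((child 0).paths.filter (·.2 = t)).map Prod.fst).toFinset ↔
      (child 0).IsPath e t := by
    simp [Node.mem_paths]
  refine ⟨_, ?_, fun e he => (mem_iff.1 he).length_le_depth.trans hd, ?_⟩
  · calc _ ≤ (child 0).paths.card := (Multiset.toFinset_card_le _).trans <| by
          rw [Multiset.card_map]
          exact Multiset.card_le_card (Multiset.filter_le _ _)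
      _ ≤ 2 ^ (child 0).depth := (hdet 0).card_paths_le
      _ ≤ 2 ^ U.hd z.dim := Nat.pow_le_pow_right two_pos hd
  · ext a
    have value_eq_iff : (child 0).Yields a t ↔ t = z.value a := by
      simpa using DTree.solvesA_iff_yields.1 hsol a t
    simp only [Set.mem_iUnion, mem_iff, exists_prop]
    exact eq_comm.trans value_eq_iff.symm

/-- The problem of recognizing whether an object solves the system of equations `e`, with answers
`1` (yes) and `2` (no). -/
def membership (e : List (U.F × Bool)) (he : e ≠ []) : U.Problem where
  dim := e.length
  dim_pos := List.length_pos_of_ne_nil he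
  ν b := if ∀ i, b i = (e.get i).2 then 1 else 2
  f i := (e.get i).1

theorem value_membership_eq_one_iff (he : e ≠ []) {a : U.A} :
    (membership e he).value a = 1 ↔ a ∈ U.solutions e := by
  simp only [membership, Problem.value, ite_eq_left_iff, solutions, Set.mem_ofPred_eq,
    List.forall_mem_iff_get]
  simp

theorem hasPathCover_solutions_hd (he : e ≠ []) :
    HasPathCover (U.solutions e) (2 ^ U.hd e.length) (U.hd e.length) := by
  have level_set : {a | (membership e he).value a = 1} = U.solutions e :=
    Set.ext fun _ => value_membership_eq_one_iff he
  exact level_set ▸ (membership e he).hasPathCover_value_eq 1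

theorem hasPathCover_solutions (hM : ∀ m, M < m → 2 * U.hd m ≤ m) (e : List (U.F × Bool)) :
    HasPathCover (U.solutions e) (2 ^ (2 * e.length)) M := by
  induction hm : e.length using Nat.strong_induction_on generalizing e with
  | _ m ih =>
    subst hm
    obtain hle | hlt := le_or_gt e.length M
    · exact (HasPathCover.of_solutions e).mono Nat.one_le_two_pow hle
    have halved := hM e.length hlt
    have shorter (e' : List (U.F × Bool)) (he' : e'.length ≤ U.hd e.length) :
        HasPathCover (U.solutions e') (2 ^ (2 * U.hd e.length)) M :=
      (ih e'.length (by omega) e' rfl).mono (Nat.pow_le_pow_right two_pos (by omega)) le_rfl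
    refine ((hasPathCover_solutions_hd (List.ne_nil_of_length_pos (by omega))).trans shorter).mono
      ?_ le_rfl
    rw [← pow_add]
    exact Nat.pow_le_pow_right two_pos (by omega)

namespace Node

/-- The node with a single path, given by a system of equations and a label. -/
def chain : List (U.F × Bool) → ℕ+ → Node U
  | [], t => terminal t
  | p :: e, t => working p.1 0 (fun _ => p.2) fun _ => chain e t

theorem size_chain (e : List (U.F × Bool)) (t : ℕ+) : (chain e t).size = e.length + 1 := by
  induction e with
  | nil => rfl
  | cons p e ih => simp [chain, size, ih, add_comm]

theorem depth_chain (e : List (U.F × Bool)) (t : ℕ+) : (chain e t).depth = e.length := by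
  induction e with
  | nil => rfl
  | cons p e ih => simp [chain, depth, ih, add_comm]

theorem yields_chain {a : U.A} {t' : ℕ+} :
    (chain e t).Yields a t' ↔ a ∈ U.solutions e ∧ t' = t := by
  induction e with
  | nil => simp [chain, yields_terminal, solutions]
  | cons p e ih =>
    simp [chain, yields_working, ih, solutions, and_assoc]

end Node

theorem DTree.exists_of_finset {P : Finset (List (U.F × Bool) × ℕ+)} (hP : P.Nonempty)
    (hl : ∀ p ∈ P, p.1.length ≤ l) :
    ∃ Γ : DTree U, (∀ a t, (∃ i, (Γ.child i).Yields a t) ↔ ∃ e, (e, t) ∈ P ∧ a ∈ U.solutions e) ∧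
      Γ.depth ≤ l ∧ Γ.size ≤ 1 + P.card * (l + 1) := by
  obtain ⟨k, hk⟩ := Nat.exists_eq_succ_of_ne_zero hP.card_pos.ne'
  let p (i : Fin (k + 1)) : P := (P.equivFinOfCardEq hk).symm i
  refine ⟨⟨k, fun i => .chain (p i).1.1 (p i).1.2⟩, fun a t => ?_, Finset.sup_le fun i _ => ?_, ?_⟩
  · simp only [Node.yields_chain]
    rw [(P.equivFinOfCardEq hk).symm.exists_congr_left]
    simp [p, and_comm]
  · rw [Node.depth_chain]
    exact hl _ (p i).2
  · refine Nat.add_le_add_left ?_ 1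
    simpa only [hk, Node.size_chain, Finset.card_univ, Fintype.card_fin, smul_eq_mul] using
      Finset.sum_le_card_nsmul Finset.univ (fun i => (p i).1.1.length + 1) (l + 1)
        fun i _ => Nat.succ_le_succ (hl _ (p i).2)

theorem Problem.exists_solvesA_of_hasPathCover (hz : (Set.range z.value).Finite)
    (h : ∀ t, HasPathCover {a | z.value a = t} N l) :
    ∃ Γ : DTree U, Γ.SolvesA z ∧ Γ.depth ≤ l ∧
      Γ.size ≤ 1 + (Set.range z.value).ncard * N * (l + 1) := by
  classical
  have := U.infinite_objects
  choose Q hQN hQl hQ using h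
  let P := hz.toFinset.biUnion fun t => (Q t).image (·, t)
  have mem_P {e t} : (e, t) ∈ P ↔ t ∈ Set.range z.value ∧ e ∈ Q t := by
    simp only [P, Finset.mem_biUnion, Set.Finite.mem_toFinset, Finset.mem_image, Prod.mk.injEq]
    grind
  have value_eq_iff {a t} : z.value a = t ↔ ∃ e ∈ Q t, a ∈ U.solutions e := by
    simpa using Set.ext_iff.1 (hQ t) a
  have card_P : P.card ≤ (Set.range z.value).ncard * N := by
    rw [Set.ncard_eq_toFinset_card _ hz]
    exact Finset.card_biUnion_le_card_mul _ _ _ fun t _ => Finset.card_image_le.trans (hQN t)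
  have nonempty : P.Nonempty := by
    obtain ⟨a⟩ : Nonempty U.A := inferInstance
    obtain ⟨e, he, -⟩ := value_eq_iff.1 (rfl : z.value a = _)
    exact ⟨_, mem_P.2 ⟨⟨a, rfl⟩, he⟩⟩
  obtain ⟨Γ, hΓ, hd, hs⟩ := DTree.exists_of_finset nonempty (l := l)
    fun p hp => hQl p.2 p.1 (mem_P.1 hp).2
  refine ⟨Γ, DTree.solvesA_iff_yields.2 fun a t => ?_, hd, hs.trans ?_⟩
  · rw [hΓ]
    constructor
    · rintro ⟨e, he, ha⟩
      exact (value_eq_iff.2 ⟨e, (mem_P.1 he).2, ha⟩).symm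
    · rintro rfl
      obtain ⟨e, he, ha⟩ := value_eq_iff.1 (rfl : z.value a = _)
      exact ⟨e, mem_P.2 ⟨⟨a, rfl⟩, he⟩, ha⟩
  · gcongr

theorem Problem.exists_shallow_solvesA (hM : ∀ m, M < m → 2 * U.hd m ≤ m) (z : U.Problem) :
    ∃ Γ : DTree U, Γ.SolvesA z ∧ Γ.depth ≤ M ∧ Γ.size ≤ (M + 2) * 2 ^ (4 * U.hd z.dim) := by
  set h := U.hd z.dim
  obtain ⟨Γ, hΓ, hd⟩ := exists_solvesD_depth_le_hd (le_refl z.dim)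
  have few_values : (Set.range z.value).ncard ≤ 2 ^ h :=
    hΓ.ncard_range_value_le.trans (Nat.pow_le_pow_right two_pos hd)
  have cover (t : ℕ+) : HasPathCover {a | z.value a = t} (2 ^ h * 2 ^ (2 * h)) M :=
    (z.hasPathCover_value_eq t).trans fun e he => (hasPathCover_solutions hM e).mono
      (Nat.pow_le_pow_right two_pos (Nat.mul_le_mul_left 2 he)) le_rfl
  obtain ⟨Γ, hΓ, hdepth, hs⟩ :=
    z.exists_solvesA_of_hasPathCover hΓ.2.finite_and_ncard_range_value_le.1 cover
  refine ⟨Γ, hΓ, hdepth, ?_⟩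
  calc Γ.size
      ≤ 1 + (Set.range z.value).ncard * (2 ^ h * 2 ^ (2 * h)) * (M + 1) := hs
    _ ≤ 2 ^ (4 * h) + 2 ^ h * (2 ^ h * 2 ^ (2 * h)) * (M + 1) := by
        gcongr
        exact Nat.one_le_two_pow
    _ = (M + 2) * 2 ^ (4 * h) := by ring

end PathCovers

section Asymptotics

variable {h : ℕ → ℕ} {ε : ℝ}

theorem one_le_logb_two {n : ℕ} (hn : 2 ≤ n) : 1 ≤ Real.logb 2 n := by
  rw [Real.le_logb_iff_rpow_le one_lt_two (by positivity), Real.rpow_one]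
  exact_mod_cast hn

theorem logb_two_rpow_le_rpow {s t : ℝ} (hs : 0 < s) (hst : s ≤ t) (n : ℕ) :
    Real.logb 2 n ^ s ≤ Real.logb 2 n ^ t := by
  obtain hn | hn := le_or_gt 2 n
  · exact Real.rpow_le_rpow_of_exponent_le (one_le_logb_two hn) hst
  · have logb_eq_zero : Real.logb 2 n = 0 := by interval_cases n <;> simp
    rw [logb_eq_zero, Real.zero_rpow hs.ne', Real.zero_rpow (hs.trans_le hst).ne']

theorem IsLOG.exists_le (hh : IsLOG h) (hε : 0 < ε) :
    ∃ c : ℝ, 0 < c ∧ ∀ n : ℕ, 1 ≤ n → (h n : ℝ) ≤ c * Real.logb 2 n ^ (1 + ε) + 1 := by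
  obtain ⟨c, hc, hb⟩ := hh (min ε (1 / 2)) (by positivity) (min_lt_of_right_lt (by norm_num))
  refine ⟨c, hc, fun n hn => (hb n hn).2.trans ?_⟩
  gcongr c * ?_ + 1
  exact logb_two_rpow_le_rpow (by positivity) (by gcongr; exact min_le_left ..) n

theorem isLittleO_logb_two_rpow (r : ℝ) :
    (fun n : ℕ => Real.logb 2 n ^ r) =o[Filter.atTop] fun n : ℕ => (n : ℝ) := by
  have log_rpow : (fun x : ℝ => Real.log x ^ r) =o[Filter.atTop] fun x => x := by
    simpa only [Real.rpow_one] using isLittleO_log_rpow_rpow_atTop r one_pos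
  refine ((log_rpow.comp_tendsto tendsto_natCast_atTop_atTop).const_mul_left
    (Real.log 2 ^ r)⁻¹).congr_left fun n => ?_
  rw [Function.comp_apply, Real.logb, Real.div_rpow (Real.log_natCast_nonneg n)
    (Real.log_nonneg one_le_two), div_eq_inv_mul]

theorem IsLOG.exists_two_mul_le (hh : IsLOG h) : ∃ M : ℕ, ∀ m, M < m → 2 * h m ≤ m := by
  obtain ⟨c, -, hb⟩ := hh.exists_le one_pos
  have sublinear : (fun n : ℕ => c * Real.logb 2 n ^ (1 + 1 : ℝ) + 1) =o[Filter.atTop]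
      fun n : ℕ => (n : ℝ) :=
    ((isLittleO_logb_two_rpow _).const_mul_left c).add <|
      (Asymptotics.isLittleO_const_id_atTop (1 : ℝ)).comp_tendsto tendsto_natCast_atTop_atTop
  obtain ⟨M, hM⟩ := Filter.eventually_atTop.1 (sublinear.bound (half_pos one_pos))
  refine ⟨M, fun m hm => ?_⟩
  have half := (hb m (by omega)).trans ((le_abs_self _).trans (hM m hm.le))
  rw [Real.norm_natCast] at half
  exact_mod_cast show (2 * h m : ℝ) ≤ m by linarith

theorem isCON_ha_of_isLOG_hd (h : IsLOG U.hd) : IsCON U.ha := by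
  obtain ⟨M, hM⟩ := h.exists_two_mul_le
  refine ⟨M + 1, by positivity, fun n hn => ?_⟩
  have ha_le : U.ha n ≤ M :=
    worstCost_le hn fun z _ => (z.exists_shallow_solvesA hM).imp fun _ h => ⟨h.1, h.2.1⟩
  exact_mod_cast ha_le.trans (Nat.le_succ M)

theorem exists_isBoundaryDPair_of_isLOG_hd (h : IsLOG U.hd) (hε : 0 < ε) :
    ∃ c : ℝ, 0 < c ∧ U.IsBoundaryDPair (fun n => c * Real.logb 2 n ^ (1 + ε) + 1)
      (fun n => (2 : ℝ) ^ (c * Real.logb 2 n ^ (1 + ε) + 2)) := by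
  obtain ⟨c, hc, hb⟩ := h.exists_le hε
  refine ⟨c, hc, fun z => ?_⟩
  obtain ⟨Γ, hΓ, hd⟩ := exists_solvesD_depth_le_hd (le_refl z.dim)
  have depth_le := (Nat.cast_le.2 hd).trans (hb z.dim z.dim_pos)
  refine ⟨Γ, hΓ, depth_le, ?_⟩
  calc (Γ.size : ℝ)
      ≤ 2 ^ (Γ.depth + 1) := by exact_mod_cast hΓ.size_le
    _ = (2 : ℝ) ^ ((Γ.depth : ℝ) + 1) := by norm_cast
    _ ≤ _ := Real.rpow_le_rpow_of_exponent_le one_le_two (by linarith)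

theorem exists_isBoundaryAPair_of_isLOG_hd (h : IsLOG U.hd) (hε : 0 < ε) :
    ∃ c₁ c₂ c₃ : ℝ, 0 < c₁ ∧ 0 < c₂ ∧ 0 < c₃ ∧ U.IsBoundaryAPair (fun _ => c₁)
      (fun n => (2 : ℝ) ^ (c₂ * Real.logb 2 n ^ (1 + ε) + c₃)) := by
  obtain ⟨c, hc, hb⟩ := h.exists_le hε
  obtain ⟨M, hM⟩ := h.exists_two_mul_le
  refine ⟨M + 1, 4 * c, M + 2 + 4, by positivity, by positivity, by positivity, fun z => ?_⟩
  obtain ⟨Γ, hΓ, hd, hs⟩ := z.exists_shallow_solvesA hM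
  have depth_le : (Γ.depth : ℝ) ≤ M + 1 := by exact_mod_cast hd.trans (Nat.le_succ M)
  refine ⟨Γ, hΓ, depth_le, ?_⟩
  have size_le : Γ.size ≤ 2 ^ (M + 2 + 4 * U.hd z.dim) := by
    rw [pow_add]
    exact hs.trans (Nat.mul_le_mul_right _ Nat.lt_two_pow_self.le)
  have := hb z.dim z.dim_pos
  calc (Γ.size : ℝ)
      ≤ 2 ^ (M + 2 + 4 * U.hd z.dim) := by exact_mod_cast size_le
    _ = (2 : ℝ) ^ (M + 2 + 4 * U.hd z.dim : ℝ) := by norm_cast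
    _ ≤ _ := Real.rpow_le_rpow_of_exponent_le one_le_two (by linarith)

theorem hd_le_self (U : InfoSystem.{u}) {n : ℕ} (hn : 1 ≤ n) : U.hd n ≤ n :=
  worstCost_le hn fun z hz => z.exists_solvesD.imp fun _ h => ⟨h.1, h.2.1.trans hz⟩

theorem isLOG_hd_of_le_log {k : ℕ} (h : ∀ n, 1 ≤ n → U.hd n ≤ Nat.log 2 n + k) :
    IsLOG U.hd := by
  intro ε hε _
  refine ⟨k + 1, by positivity, fun n hn => ⟨?_, ?_⟩⟩
  · rw [Real.logb_le_iff_le_rpow one_lt_two (by positivity), Real.rpow_natCast]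
    exact_mod_cast U.lt_two_pow_hd hn
  obtain rfl | hn2 := hn.eq_or_lt
  · have : (U.hd 1 : ℝ) ≤ 1 := by exact_mod_cast U.hd_le_self le_rfl
    simpa [Real.zero_rpow (by positivity : 1 + ε ≠ 0)] using this
  have one_le := one_le_logb_two hn2
  calc (U.hd n : ℝ)
      ≤ Nat.log 2 n + k := by exact_mod_cast h n hn
    _ ≤ Real.logb 2 n + k * Real.logb 2 n := by
        gcongr
        · exact Real.natLog_le_logb n 2
        · exact le_mul_of_one_le_right (Nat.cast_nonneg k) one_le
    _ = (k + 1) * Real.logb 2 n ^ (1 : ℝ) := by rw [Real.rpow_one]; ring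
    _ ≤ (k + 1) * Real.logb 2 n ^ (1 + ε) := by
        gcongr (k + 1) * ?_
        exact logb_two_rpow_le_rpow one_pos (by linarith) n
    _ ≤ _ := le_add_of_nonneg_right zero_le_one

theorem inW1_of_iDim_eq {d : ℕ} (hI : U.iDim = d) (h : IsLOG U.hd) : U.InW1 :=
  ⟨h, isCON_ha_of_isLOG_hd h, isPOL_of_iDim_eq hI⟩

end Asymptotics

theorem exists_eq_append_cons_of_length_lt {α : Type*} {l : List α} {D : ℕ} (hl : l ≠ [])
    (hD : l.length < 2 ^ (D + 1)) :
    ∃ l₁ a l₂, l = l₁ ++ a :: l₂ ∧ l₁.length < 2 ^ D ∧ l₂.length < 2 ^ D := by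
  have hpos := List.length_pos_of_ne_nil hl
  have hmid : l.length / 2 < l.length := by omega
  rw [pow_succ] at hD
  refine ⟨l.take (l.length / 2), l[l.length / 2], l.drop (l.length / 2 + 1), ?_, ?_, ?_⟩
  · rw [← List.drop_eq_getElem_cons, List.take_append_drop]
  · rw [List.length_take]
    omega
  · rw [List.length_drop]
    omega

namespace ComputableWithin

theorem of_antitone_list {gs : List U.F} {D : ℕ} (hgs : gs.Pairwise (· ≥ ·))
    (hD : gs.length < 2 ^ D)
    (hcell : ∀ Y ⊆ X, (∀ g ∈ gs, ∃ δ, ∀ a ∈ Y, g.1 a = δ) → ComputableWithin val Y d s) :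
    ComputableWithin val X (D + d) (gs.length + (gs.length + 1) * s) := by
  induction D generalizing gs X with
  | zero =>
    obtain rfl : gs = [] := List.eq_nil_of_length_eq_zero (by omega)
    simpa using hcell X subset_rfl (by simp)
  | succ D ih =>
    obtain rfl | hne := eq_or_ne gs []
    · exact (hcell X subset_rfl (by simp)).mono (by omega) (by simp)
    obtain ⟨l, g, r, rfl, hl, hr⟩ := exists_eq_append_cons_of_length_lt hne hD
    obtain ⟨hpl, hpgr, hlr⟩ := List.pairwise_append.1 hgs
    obtain ⟨hpg, hpr⟩ := List.pairwise_cons.1 hpgr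
    have hfalse : ComputableWithin val {a ∈ X | g.1 a = false} (D + d)
        (l.length + (l.length + 1) * s) := ih hpl hl fun Y hY hconst => by
      refine hcell Y (fun a ha => (hY ha).1) fun k hk => ?_
      obtain hk | hk := List.mem_append.1 hk
      · exact hconst k hk
      have hkg : k ≤ g := (List.mem_cons.1 hk).elim le_of_eq (hpg k)
      exact ⟨false, fun a ha => le_bot_iff.1 ((hkg a).trans_eq (hY ha).2)⟩
    have htrue : ComputableWithin val {a ∈ X | g.1 a = true} (D + d)
        (r.length + (r.length + 1) * s) := ih hpr hr fun Y hY hconst => by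
      refine hcell Y (fun a ha => (hY ha).1) fun k hk => ?_
      obtain hk | hk | hk : k ∈ l ∨ k = g ∨ k ∈ r := by simpa using hk
      · exact ⟨true, fun a ha => top_le_iff.1 ((hY ha).2.symm.trans_le (hlr k hk g (by simp) a))⟩
      · exact ⟨true, fun a ha => hk ▸ (hY ha).2⟩
      · exact hconst k hk
    refine (query (f := g) (s := fun b => bif b then _ else _) (Bool.forall_bool.2
      ⟨hfalse, htrue⟩)).mono (by omega) (le_of_eq ?_)
    simp only [cond_false, cond_true, List.length_append, List.length_cons]
    ring

theorem of_antitone {ι : Type*} [LinearOrder ι] {q : ι → U.F} (hq : Antitone q) {S : Finset ι}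
    {D : ℕ} (hD : S.card < 2 ^ D)
    (hcell : ∀ Y ⊆ X, (∀ i ∈ S, ∃ δ, ∀ a ∈ Y, (q i).1 a = δ) → ComputableWithin val Y d s) :
    ComputableWithin val X (D + d) (S.card + (S.card + 1) * s) := by
  have hlength : ((S.sort (· ≤ ·)).map q).length = S.card := by simp
  rw [← hlength] at hD ⊢
  refine of_antitone_list (List.pairwise_map.2 ((S.pairwise_sort (· ≤ ·)).imp fun h => hq h)) hD
    fun Y hY hconst => hcell Y hY fun i hi => hconst (q i) ?_
  exact List.mem_map_of_mem ((Finset.mem_sort _).2 hi)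

end ComputableWithin

/-- The attribute `l_i` as an element of the attribute set of `U₁`. -/
def thresholdL (i : ℕ+) : U₁.F := ⟨attrL i, i, rfl⟩

theorem antitone_thresholdL : Antitone thresholdL := fun i j hij a => by
  change attrL j a ≤ attrL i a
  simpa [attrL, Bool.le_iff_imp] using hij.trans_lt

theorem pairDependent_U₁ : U₁.PairDependent := by
  have not_and_of_le : ∀ {i j : ℕ+}, i ≤ j → ∀ a, ¬ (attrL i a = false ∧ attrL j a = true) := by
    rintro i j hij a ⟨hi, hj⟩
    exact absurd (Bool.le_iff_imp.1 (antitone_thresholdL hij a) hj) (by simp [thresholdL, hi])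
  rintro _ ⟨i, rfl⟩ _ ⟨j, rfl⟩ -
  obtain h | h := le_total i j
  · exact ⟨false, true, not_and_of_le h⟩
  · exact ⟨true, false, fun a ha => not_and_of_le h a ha.symm⟩

theorem exists_solvesD_U₁ (z : U₁.Problem) {D : ℕ} (hD : z.dim < 2 ^ D) :
    ∃ Γ : DTree U₁, Γ.SolvesD z ∧ Γ.depth ≤ D ∧ Γ.size ≤ 2 * (z.dim + 1) := by
  choose i hi using fun k => (z.f k).2
  have hcard : (Finset.univ.image i).card ≤ z.dim := Finset.card_image_le.trans (by simp)
  obtain ⟨Γ, hΓ, hdepth, hsize⟩ := DTree.exists_solvesD_of_computableWithin <|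
    ComputableWithin.of_antitone antitone_thresholdL (hcard.trans_lt hD) fun Y _ hY =>
      ComputableWithin.of_constant fun a ha b hb => z.value_eq_of_forall_eq fun k => by
        obtain ⟨δ, hδ⟩ := hY (i k) (by simp)
        rw [← hi k]
        exact (hδ a ha).trans (hδ b hb).symm
  exact ⟨Γ, hΓ, hdepth, by omega⟩

theorem inW1_U₁ : U₁.InW1 :=
  inW1_of_iDim_eq (d := 1) pairDependent_U₁.iDim_eq_one <|
    isLOG_hd_of_le_log (k := 1) fun n hn => worstCost_le hn fun z hz =>
      have hdim := hz.trans_lt (Nat.lt_pow_succ_log_self one_lt_two n)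
      (exists_solvesD_U₁ z hdim).imp fun _ h => ⟨h.1, h.2.1⟩

theorem dReachable_U₁ : U₁.DReachable := fun z => by
  obtain ⟨Γ, hΓ, hdepth, hsize⟩ := exists_solvesD_U₁ z (U₁.lt_two_pow_hd z.dim_pos)
  have hLd := (U₁.two_mul_succ_le_La z.dim_pos).trans (U₁.La_le_Ld z.dim_pos)
  exact ⟨Γ, hΓ, Nat.cast_le.2 hdepth, Nat.cast_le.2 (hsize.trans hLd)⟩

section IdentificationTrees

variable {n : ℕ} {f : Fin n → U.F} {Γ : DTree U}

theorem identify_value_ne (hn : 0 < n) {a b : U.A} {k : Fin n} (h : (f k).1 a ≠ (f k).1 b) :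
    (identify hn f).value a ≠ (identify hn f).value b := fun hab =>
  h (congrFun (Encodable.encode_injective (Nat.succPNat_injective hab)) k)

theorem lt_ncard_patterns_of_forall_exists {o : U.A}
    (h : ∀ j, ∃ c, ∀ k, (f k).1 o ≠ (f k).1 c ↔ k = j) : n < (patterns f).ncard := by
  choose c hc using h
  have injective_patterns : Function.Injective fun j k => (f k).1 (c j) := fun i j hij =>
    (hc j i).1 (((hc i i).2 rfl).trans_eq (congrFun hij i))
  have notMem_range : (fun k => (f k).1 o) ∉ Set.range fun j k => (f k).1 (c j) := by
    rintro ⟨j, hj⟩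
    exact (hc j j).2 rfl (congrFun hj j).symm
  calc n < (insert (fun k => (f k).1 o) (Set.range fun j k => (f k).1 (c j))).ncard := by
        rw [Set.ncard_insert_of_notMem notMem_range,
          Set.ncard_range_of_injective injective_patterns,
          Nat.card_fin]
        exact Nat.lt_succ_self n
    _ ≤ (patterns f).ncard := by
        refine Set.ncard_le_ncard (Set.insert_subset ⟨o, rfl⟩ ?_)
        rintro _ ⟨j, rfl⟩
        exact ⟨c j, rfl⟩

namespace DTree

theorem SolvesA.exists_path_separating (h : Γ.SolvesA z) (a : U.A) :
    ∃ i e t, (Γ.child i).IsPath e t ∧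
      ∀ b, z.value a ≠ z.value b → ∃ p ∈ e, p.1.1 a ≠ p.1.1 b := by
  obtain ⟨e, t, ⟨i, he⟩, ha⟩ := h.1 a
  refine ⟨i, e, t, he, fun b hab => ?_⟩
  by_contra! heq
  have hb : b ∈ U.solutions e := fun p hp => (heq p hp).symm.trans (ha p hp)
  exact hab ((h.2 a e t ⟨i, he⟩ ha).symm.trans (h.2 b e t ⟨i, he⟩ hb))

theorem SolvesA.mem_range_of_mem_attrs {hn : 0 < n} (h : Γ.SolvesA (identify hn f))
    (hf : Function.Injective f) (hpatterns : n < (patterns f).ncard) (hsize : Γ.size ≤ 2 * (n + 1))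
    (hsep : ∀ j, ∃ a b, ∀ g : U.F, g.1 a ≠ g.1 b ↔ g = f j) {i : Fin (Γ.k + 1)} {g : U.F}
    (hg : g ∈ (Γ.child i).attrs) : g ∈ Set.range f := by
  classical
  let attrs := ∑ i, (Γ.child i).attrs
  have card_attrs_le : attrs.card ≤ n := by
    have := h.finite_and_ncard_range_value_le.2
    rw [ncard_range_value_identify] at this
    have := Γ.size_eq_sum_card_attrs_add_sum_card_paths
    rw [Multiset.card_sum]
    omega
  have image_subset : Finset.univ.image f ⊆ attrs.toFinset := by
    refine Finset.image_subset_iff.2 fun j _ => ?_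
    obtain ⟨a, b, hab⟩ := hsep j
    obtain ⟨i, e, t, he, hpath⟩ := h.exists_path_separating a
    obtain ⟨p, hp, hpab⟩ := hpath b (identify_value_ne hn ((hab (f j)).2 rfl))
    rw [Multiset.mem_toFinset, Multiset.mem_sum, ← (hab p.1).1 hpab]
    exact ⟨i, Finset.mem_univ i, he.mem_attrs hp⟩
  have image_eq : Finset.univ.image f = attrs.toFinset := by
    refine Finset.eq_of_subset_of_card_le image_subset ?_
    rw [Finset.card_image_of_injective _ hf, Finset.card_univ, Fintype.card_fin]
    exact (Multiset.toFinset_card_le _).trans card_attrs_le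
  have mem_image : g ∈ Finset.univ.image f := by
    rw [image_eq, Multiset.mem_toFinset, Multiset.mem_sum]
    exact ⟨i, Finset.mem_univ i, hg⟩
  simpa using mem_image

theorem SolvesA.le_depth_of_size_le {hn : 0 < n} (h : Γ.SolvesA (identify hn f))
    (hsize : Γ.size ≤ 2 * (n + 1)) (hsep : ∀ j, ∃ a b, ∀ g : U.F, g.1 a ≠ g.1 b ↔ g = f j)
    {o : U.A} (ho : ∀ j, ∃ c, ∀ k, (f k).1 o ≠ (f k).1 c ↔ k = j) : n ≤ Γ.depth := by
  classical
  have hf : Function.Injective f := fun i j hij => by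
    obtain ⟨c, hc⟩ := ho j
    exact (hc i).1 (hij ▸ (hc j).2 rfl)
  obtain ⟨i, e, t, he, hpath⟩ := h.exists_path_separating o
  have image_subset : Finset.univ.image f ⊆ (e.map Prod.fst).toFinset := by
    refine Finset.image_subset_iff.2 fun j _ => ?_
    obtain ⟨c, hc⟩ := ho j
    obtain ⟨p, hp, hpc⟩ := hpath c (identify_value_ne hn ((hc j).2 rfl))
    obtain ⟨k, hk⟩ := h.mem_range_of_mem_attrs hf (lt_ncard_patterns_of_forall_exists ho) hsize
      hsep (he.mem_attrs hp)
    rw [← hk, hc] at hpc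
    rw [List.mem_toFinset, ← hpc, hk]
    exact List.mem_map_of_mem hp
  calc n = (Finset.univ.image f).card := by simp [Finset.card_image_of_injective _ hf]
    _ ≤ (e.map Prod.fst).length :=
        (Finset.card_le_card image_subset).trans (List.toFinset_card_le _)
    _ ≤ (Γ.child i).depth := by simpa using he.length_le_depth
    _ ≤ Γ.depth := Γ.depth_child_le i

end DTree

end IdentificationTrees

section PointThresholdSystem

/-- The attribute `p_i` as an element of the attribute set of `U₆`. -/
noncomputable def pointP (i : ℕ+) : U₆.F := ⟨attrP i, .inl ⟨i, rfl⟩⟩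

/-- The attribute `q_i` as an element of the attribute set of `U₆`. -/
noncomputable def thresholdQ (i : ℕ+) : U₆.F := ⟨attrQ i, .inr ⟨i, rfl⟩⟩

theorem eq_pointP_or_eq_thresholdQ (g : U₆.F) : ∃ i, g = pointP i ∨ g = thresholdQ i := by
  obtain ⟨_, ⟨i, rfl⟩ | ⟨i, rfl⟩⟩ := g
  · exact ⟨i, .inl rfl⟩
  · exact ⟨i, .inr rfl⟩

theorem attrP_eq_true {i : ℕ+} {a : ℝ≥0} : attrP i a = true ↔ a = (i : ℕ) := by
  simp [attrP]

theorem attrQ_eq_true {i : ℕ+} {a : ℝ≥0} : attrQ i a = true ↔ ((i : ℕ) : ℝ) + 1 / 2 ≤ a := by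
  simp [attrQ, ← NNReal.coe_le_coe]

theorem attrQ_natCast {i : ℕ+} {m : ℕ} : attrQ i m = true ↔ (i : ℕ) < m := by
  rw [attrQ_eq_true, NNReal.coe_natCast]
  refine ⟨fun h => ?_, fun h => ?_⟩
  · exact_mod_cast (by linarith : ((i : ℕ) : ℝ) < m)
  · have : ((i : ℕ) : ℝ) + 1 ≤ m := by exact_mod_cast h
    linarith

theorem antitone_thresholdQ : Antitone thresholdQ := fun i j hij (a : ℝ≥0) => by
  change attrQ j a ≤ attrQ i a
  have : ((i : ℕ) : ℝ) ≤ (j : ℕ) := by exact_mod_cast hij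
  rw [Bool.le_iff_imp, attrQ_eq_true, attrQ_eq_true]
  exact fun h => by linarith

theorem pairDependent_U₆ : U₆.PairDependent := by
  have thresholds : ∀ {i j : ℕ+}, i ≤ j → ∀ a, ¬ (attrQ i a = false ∧ attrQ j a = true) := by
    rintro i j hij a ⟨hi, hj⟩
    exact absurd (Bool.le_iff_imp.1 (antitone_thresholdQ hij a) hj) (by simp [thresholdQ, hi])
  have point_threshold : ∀ i j : ℕ+, ∃ ε, ∀ a, ¬ (attrP i a = true ∧ attrQ j a = ε) := by
    refine fun i j => ⟨!(attrQ j (i : ℕ)), ?_⟩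
    rintro a ⟨hi, hj⟩
    rw [attrP_eq_true.1 hi] at hj
    simp at hj
  rintro _ (⟨i, rfl⟩ | ⟨i, rfl⟩) _ (⟨j, rfl⟩ | ⟨j, rfl⟩) hne
  · refine ⟨true, true, fun a ⟨hi, hj⟩ => hne ?_⟩
    have hij := (attrP_eq_true.1 hi).symm.trans (attrP_eq_true.1 hj)
    rw [PNat.coe_injective (Nat.cast_injective hij)]
  · obtain ⟨ε, h⟩ := point_threshold i j
    exact ⟨true, ε, h⟩
  · obtain ⟨ε, h⟩ := point_threshold j i
    exact ⟨ε, true, fun a ha => h a ha.symm⟩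
  · obtain h | h := le_total i j
    · exact ⟨false, true, thresholds h⟩
    · exact ⟨true, false, fun a ha => thresholds h a ha.symm⟩

theorem le_of_attrQ_eq {i j : ℕ+} (h : attrQ i (i : ℕ) = attrQ i (j : ℕ)) : j ≤ i := by
  rw [Bool.eq_iff_iff, attrQ_natCast, attrQ_natCast] at h
  exact not_lt.1 fun hij => lt_irrefl _ (h.2 hij)

theorem computableWithin_of_thresholds_constant {z : U₆.Problem} {Y : Set ℝ≥0}
    {i : Fin z.dim → ℕ+} (hi : ∀ k, z.f k = pointP (i k) ∨ z.f k = thresholdQ (i k))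
    (hY : ∀ k, ∀ a ∈ Y, ∀ b ∈ Y, attrQ (i k) a = attrQ (i k) b) :
    ComputableWithin z.value Y 1 3 := by
  have unique_point : ∃ m, ∀ k, ((i k : ℕ) : ℝ≥0) ∈ Y → i k = m := by
    by_cases h : ∃ l, ((i l : ℕ) : ℝ≥0) ∈ Y
    · obtain ⟨l, hl⟩ := h
      exact ⟨i l, fun k hk => le_antisymm (le_of_attrQ_eq (hY l _ hl _ hk))
        (le_of_attrQ_eq (hY k _ hk _ hl))⟩
    · exact ⟨1, fun k hk => absurd ⟨k, hk⟩ h⟩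
  obtain ⟨m, hm⟩ := unique_point
  refine ComputableWithin.query (f := pointP m) (d := 0) (s := fun _ => 1) fun δ => ?_
  refine ComputableWithin.of_constant fun a ⟨ha, haδ⟩ b ⟨hb, hbδ⟩ => ?_
  refine z.value_eq_of_forall_eq fun k => ?_
  obtain hk | hk := hi k <;> rw [hk]
  · obtain h | h := eq_or_ne (i k) m
    · rw [h, haδ, hbδ]
    · have attrP_eq_false : ∀ c ∈ Y, attrP (i k) c = false := fun c hc =>
        Bool.eq_false_of_not_eq_true fun hkc => h (hm k (attrP_eq_true.1 hkc ▸ hc))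
      exact (attrP_eq_false a ha).trans (attrP_eq_false b hb).symm
  · exact hY k a ha b hb

theorem exists_solvesD_U₆ (z : U₆.Problem) {D : ℕ} (hD : z.dim < 2 ^ D) :
    ∃ Γ : DTree U₆, Γ.SolvesD z ∧ Γ.depth ≤ D + 1 := by
  choose i hi using fun k => eq_pointP_or_eq_thresholdQ (z.f k)
  have hcard : (Finset.univ.image i).card ≤ z.dim := Finset.card_image_le.trans (by simp)
  obtain ⟨Γ, hΓ, hdepth, -⟩ := DTree.exists_solvesD_of_computableWithin <|
    ComputableWithin.of_antitone antitone_thresholdQ (hcard.trans_lt hD) fun Y _ hY =>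
      computableWithin_of_thresholds_constant hi fun k a ha b hb => by
        obtain ⟨δ, hδ⟩ := hY (i k) (by simp)
        exact (hδ a ha).trans (hδ b hb).symm
  exact ⟨Γ, hΓ, hdepth⟩

theorem hd_U₆_le {n : ℕ} (hn : 1 ≤ n) : U₆.hd n ≤ Nat.log 2 n + 2 :=
  worstCost_le hn fun z hz =>
    exists_solvesD_U₆ z (hz.trans_lt (Nat.lt_pow_succ_log_self one_lt_two n))

theorem inW1_U₆ : U₆.InW1 :=
  inW1_of_iDim_eq (d := 1) pairDependent_U₆.iDim_eq_one (isLOG_hd_of_le_log fun _ => hd_U₆_le)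

theorem ne_add_quarter_iff {g : U₆.F} {i : ℕ+} :
    g.1 ((i : ℕ) : ℝ≥0) ≠ g.1 (((i : ℕ) : ℝ≥0) + 1 / 4 : ℝ≥0) ↔ g = pointP i := by
  have hP : ∀ j, attrP j (((i : ℕ) : ℝ≥0) + 1 / 4) = false := fun j => by
    rw [← Bool.not_eq_true, attrP_eq_true, ← NNReal.coe_inj]
    push_cast
    intro h
    have lt : (i : ℕ) < (j : ℕ) := by exact_mod_cast (by linarith : ((i : ℕ) : ℝ) < (j : ℕ))
    have lt_succ : (j : ℕ) < (i : ℕ) + 1 := by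
      exact_mod_cast (by linarith : ((j : ℕ) : ℝ) < (i : ℕ) + 1)
    omega
  have hQ : ∀ j, attrQ j ((i : ℕ) : ℝ≥0) = attrQ j (((i : ℕ) : ℝ≥0) + 1 / 4) := fun j => by
    rw [Bool.eq_iff_iff, attrQ_natCast, attrQ_eq_true]
    push_cast
    refine ⟨fun h => ?_, fun h => ?_⟩
    · have : ((j : ℕ) : ℝ) + 1 ≤ (i : ℕ) := by exact_mod_cast h
      linarith
    · exact_mod_cast (by linarith : ((j : ℕ) : ℝ) < (i : ℕ))
  constructor
  · intro h
    obtain ⟨j, rfl | rfl⟩ := eq_pointP_or_eq_thresholdQ g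
    · have hj : attrP j (i : ℕ) = true := Bool.eq_true_of_not_eq_false fun hj =>
        h (hj.trans (hP j).symm)
      rw [PNat.coe_injective (Nat.cast_injective (attrP_eq_true.1 hj))]
    · exact absurd (hQ j) h
  · rintro rfl h
    exact absurd ((attrP_eq_true.2 rfl).symm.trans (h.trans (hP i))) (by simp)

theorem attrP_zero_ne_iff {k j : ℕ+} : attrP k 0 ≠ attrP k (j : ℕ) ↔ k = j := by
  have hk : attrP k 0 = false := decide_eq_false (Nat.cast_ne_zero.2 k.ne_zero).symm
  rw [hk, ne_comm, Bool.ne_false_iff, attrP_eq_true, Nat.cast_inj, PNat.coe_inj, eq_comm]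

-- At dimension `5` both bounds are tight enough: a tree with at most `L^d(5) ≤ 12` nodes that
-- identifies `p₁, …, p₅` has depth at least `5`, whereas `h^d(5) ≤ 4`.
theorem not_dReachable_U₆ : ¬ U₆.DReachable := fun h => by
  let f : Fin 5 → U₆.F := fun j => pointP (Nat.succPNat j)
  obtain ⟨Γ, hΓ, hdepth, hsize⟩ := h (identify (by norm_num) f)
  have hd_le : U₆.hd 5 ≤ 4 := (hd_U₆_le (by norm_num)).trans (by norm_num)
  have Ld_le : U₆.Ld 5 ≤ 2 * (5 + 1) :=
    (Ld_le_of_iDim_le (d := 1) pairDependent_U₆.iDim_eq_one.le (by norm_num)).trans (by norm_num)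
  have le_depth : 5 ≤ Γ.depth :=
    hΓ.2.le_depth_of_size_le ((Nat.cast_le.1 hsize).trans Ld_le)
      (fun j => ⟨_, _, fun g => ne_add_quarter_iff⟩) (o := (0 : ℝ≥0)) fun j =>
        ⟨((Nat.succPNat j : ℕ) : ℝ≥0), fun k => attrP_zero_ne_iff.trans <|
          Nat.succPNat_inj.trans Fin.val_inj⟩
  exact absurd ((Nat.cast_le.1 hdepth).trans hd_le) (by omega)

end PointThresholdSystem

end InfoSystem

theorem theorem2_general :
    (InfoSystem.U₁.InW1 ∧ InfoSystem.U₁.DReachable) ∧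
    (InfoSystem.U₆.InW1 ∧ ¬ InfoSystem.U₆.DReachable) ∧
    (∀ U : InfoSystem.{u}, InfoSystem.IsCON U.ha → ¬ U.AReachable) ∧
    ∀ U : InfoSystem.{u}, InfoSystem.IsLOG U.hd → ∀ ε : ℝ, 0 < ε →
      (∃ c : ℝ, 0 < c ∧
        U.IsBoundaryDPair
          (fun n => c * (Real.logb 2 n) ^ (1 + ε) + 1)
          (fun n => (2 : ℝ) ^ (c * (Real.logb 2 n) ^ (1 + ε) + 2))) ∧
      ∃ c₁ c₂ c₃ : ℝ, 0 < c₁ ∧ 0 < c₂ ∧ 0 < c₃ ∧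
        U.IsBoundaryAPair
          (fun _ => c₁)
          (fun n => (2 : ℝ) ^ (c₂ * (Real.logb 2 n) ^ (1 + ε) + c₃)) :=
  ⟨⟨InfoSystem.inW1_U₁, InfoSystem.dReachable_U₁⟩,
    ⟨InfoSystem.inW1_U₆, InfoSystem.not_dReachable_U₆⟩,
    fun _ hCON => InfoSystem.not_AReachable_of_isCON_ha hCON,
    fun _ hLOG _ hε => ⟨InfoSystem.exists_isBoundaryDPair_of_isLOG_hd hLOG hε,
      InfoSystem.exists_isBoundaryAPair_of_isLOG_hd hLOG hε⟩⟩

theorem theorem2 :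
    -- (a) existence
    (InfoSystem.U₁.InW1 ∧ InfoSystem.U₁.DReachable) ∧
    (InfoSystem.U₆.InW1 ∧ ¬ InfoSystem.U₆.DReachable) ∧
    -- (a) boundary `d`-pairs
    (∀ U : InfoSystem.{u}, U.InW1 → ¬ U.DReachable → ∀ ε : ℝ, 0 < ε → ε < 1 →
      ∃ c : ℝ, 0 < c ∧
        U.IsBoundaryDPair
          (fun n => c * (Real.logb 2 n) ^ (1 + ε) + 1)
          (fun n => (2 : ℝ) ^ (c * (Real.logb 2 n) ^ (1 + ε) + 2))) ∧
    -- (b)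
    (∀ U : InfoSystem.{u}, U.InW1 →
      ¬ U.AReachable ∧
      ∀ ε : ℝ, 0 < ε → ε < 1 →
        ∃ c₁ c₂ c₃ : ℝ, 0 < c₁ ∧ 0 < c₂ ∧ 0 < c₃ ∧
          U.IsBoundaryAPair
            (fun _ => c₁)
            (fun n => (2 : ℝ) ^ (c₂ * (Real.logb 2 n) ^ (1 + ε) + c₃))) := by
  obtain ⟨hU₁, hU₆, not_reachable, boundary⟩ := theorem2_general.{u}
  exact ⟨hU₁, hU₆, fun U hU _ ε hε _ => (boundary U hU.1 ε hε).1,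
    fun U hU => ⟨not_reachable U hU.2.1, fun ε hε _ => (boundary U hU.1 ε hε).2⟩⟩
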